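/- Conventions. On $\mathbb{R}^2$ let $\hat f(\xi)=\int e^{-ix\cdot\xi}f(x)\,dx$ (extended to $L^2$), $\widehat{(-\Delta)^s f}=|\xi|^{2s}\hat f$, $\nabla^\perp=(\partial_2,-\partial_1)$ and $\|f\|_{H^3}^2=(2\pi)^{-2}\int(1+|\xi|^2)^3|\hat f(\xi)|^2\,d\xi$. Let $\mu>0$, $0\le\alpha<\frac12$ and $\sigma\in\{-\frac12,\frac12\}$ ($\sigma=-\frac12$ is the velocity law of the surface quasi-geostrophic equation). For an initial temperature $\Theta_0$ put $\Theta(t)=e^{-\mu t(-\Delta)^\alpha}\Theta_0$, that is, $\partial_t\Theta+\mu(-\Delta)^\alpha\Theta=0$, $\Theta|_{t=0}=\Theta_0$, and $U=\nabla^\perp(-\Delta)^{\sigma}\Theta$, $U_0=\nabla^\perp(-\Delta)^{\sigma}\Theta_0$. For a function $g_0$ and constants $C,\epsilon>0$ consider the condition $$\Big(\|g_0\|_{H^3}^2+\int_0^\infty\|U\cdot\nabla\Theta\|_{H^3}\,dt\Big)\exp\Big(C\Big(\int_0^\infty\big(\|U\|_{L^\infty}+\|\Theta\|_{L^\infty}\big)dt+\int_0^\infty\|U\cdot\nabla\Theta\|_{H^3}\,dt\Big)\Big)\le\epsilon.\qquad(*)$$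 Statement. Let $\mu>0$ and $0<C\le 40\mu$. There is $\delta_0>0$, depending only on $\mu$ and $C$, such that the following holds for all $0<\delta\le\delta_0$, all $\alpha\in[0,\frac12)$ and both values of $\sigma$. Let $\chi\in C^\infty(\mathbb{R}^2)\cap L^2(\mathbb{R}^2)$ be real-valued with $\hat\chi(-\xi)=\hat\chi(\xi)$, $0\le\hat\chi\le1$, $\hat\chi(\xi)=1$ for $|\xi_1-\xi_2|\le\frac13\delta$, $\frac43\le|\xi|\le\frac32$, and $\hat\chi$ supported in $\{|\xi_1-\xi_2|\le\delta,\ \frac43\le|\xi|\le\frac32\}$ (almost everywhere, since $\hat\chi\in L^2$). Let $\Theta_0=\delta^{-1}(\log|\log\delta|)\,\chi$ and $\epsilon=\delta^{1/2}|\log\delta|^2$. If $g_0\in H^3(\mathbb{R}^2)$ is real-valued and $\|g_0\|_{H^3}^2\le\delta^{1/2}$, then $\epsilon\in(0,e^{-100}]$ and $(*)$ holds, all quantities in it being finite. Moreover $$\|U_0\|_{L^\infty},\ \|\Theta_0\|_{L^\infty}\ \ge\ \tfrac1{5000}\log|\log\delta|,\qquad \|U_0\|_{L^2},\ \|\Theta_0\|_{L^2}\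 \ge\ \tfrac1{100}\,\delta^{-1/2}\log|\log\delta|.$$ In particular the data can be arbitrarily large: for every $K$ there are $\delta\in(0,\delta_0]$ and a function $\chi$ as above for which these four norms are all at least $K$, for both values of $\sigma$. -/

import Mathlib

open MeasureTheory Set
open scoped ENNReal FourierTransform ContDiff

noncomputable section

namespace SQG

/-- The Euclidean plane `ℝ²`. -/
abbrev Plane : Type := EuclideanSpace ℝ (Fin 2)

open Classical in
/-- The Fourier transform `f̂(ξ) = ∫ e^{-i x·ξ} f(x) dx` of a real function `f ∈ L²(ℝ²)`, in the
sense of Plancherel (defined up to null sets; `0` if `f ∉ L²`). Mathlib's transform has the kernel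
`e^{-2πi x·ξ}`, hence the rescaling of the frequency. -/
def hat (f : Plane → ℝ) : Plane → ℂ :=
  if h : MemLp (fun x => (f x : ℂ)) 2 (volume : Measure Plane) then
    fun ξ => (𝓕 (h.toLp (fun x => (f x : ℂ))) : Lp ℂ 2 (volume : Measure Plane))
      ((2 * Real.pi)⁻¹ • ξ)
  else 0

/-- The Fourier multiplier with real symbol `m`:
`x ↦ (2π)⁻² ∫ e^{i x·ξ} m(ξ) f̂(ξ) dξ`, for `f ∈ L²` with `m f̂` integrable (for instance, `f̂`
supported in an annulus and `m` bounded there). The symbols below are even and `f` is real, so the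
integral is real and taking the real part changes nothing. -/
def multiplier (m : Plane → ℝ) (f : Plane → ℝ) (x : Plane) : ℝ :=
  ((2 * Real.pi) ^ 2)⁻¹ *
    (∫ ξ : Plane, Complex.exp (Complex.I * (inner ℝ x ξ : ℝ)) * (m ξ : ℂ) * hat f ξ).re

/-- `(-Δ)^s`, with symbol `|ξ|^{2s}`. -/
def fracLaplacian (s : ℝ) (f : Plane → ℝ) : Plane → ℝ :=
  multiplier (fun ξ => ‖ξ‖ ^ (2 * s)) f

/-- `e^{-μ t (-Δ)^α} f`, the solution at time `t` of `∂ₜΘ + μ (-Δ)^α Θ = 0`, `Θ|_{t=0} = f`. -/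
def linearFlow (μ α : ℝ) (f : Plane → ℝ) (t : ℝ) : Plane → ℝ :=
  multiplier (fun ξ => Real.exp (-(μ * t * ‖ξ‖ ^ (2 * α)))) f

/-- The partial derivative `∂ᵢ f`. -/
def partialDeriv (i : Fin 2) (f : Plane → ℝ) (x : Plane) : ℝ :=
  fderiv ℝ f x (EuclideanSpace.single i 1)

/-- The velocity `∇^⊥ (-Δ)^σ f` with `∇^⊥ = (∂₂, -∂₁)`. -/
def velocity (σ : ℝ) (f : Plane → ℝ) (x : Plane) : Plane :=
  !₂[partialDeriv 1 (fracLaplacian σ f) x, -partialDeriv 0 (fracLaplacian σ f) x]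

/-- The transport term `V · ∇f`. -/
def transport (V : Plane → Plane) (f : Plane → ℝ) (x : Plane) : ℝ :=
  ∑ i : Fin 2, V x i * partialDeriv i f x

open Classical in
/-- The norm of the Sobolev space `H^s(ℝ²)`, `s ≥ 0`:
`‖f‖_{H^s}² = (2π)⁻² ∫ (1 + |ξ|²)^s |f̂(ξ)|² dξ`, infinite if `f ∉ H^s`. -/
def sobolevNorm (s : ℝ) (f : Plane → ℝ) : ℝ≥0∞ :=
  if MemLp f 2 (volume : Measure Plane) then
    (ENNReal.ofReal ((2 * Real.pi) ^ 2)⁻¹ *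
      ∫⁻ ξ : Plane, ENNReal.ofReal ((1 + ‖ξ‖ ^ 2) ^ s * ‖hat f ξ‖ ^ 2)) ^ (1 / 2 : ℝ)
  else ⊤

/-- `∫₀^∞ ‖U, Θ‖_{L^∞} dt` for `Θ = e^{-μt(-Δ)^α} Θ₀` and `U = ∇^⊥(-Δ)^σ Θ`. -/
def supIntegral (μ α σ : ℝ) (Θ₀ : Plane → ℝ) : ℝ≥0∞ :=
  ∫⁻ t in Ioi (0 : ℝ),
    (eLpNorm (velocity σ (linearFlow μ α Θ₀ t)) ⊤ (volume : Measure Plane) +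
      eLpNorm (linearFlow μ α Θ₀ t) ⊤ (volume : Measure Plane))

/-- `∫₀^∞ ‖U·∇Θ‖_{H³} dt` for `Θ = e^{-μt(-Δ)^α} Θ₀` and `U = ∇^⊥(-Δ)^σ Θ`. -/
def transportIntegral (μ α σ : ℝ) (Θ₀ : Plane → ℝ) : ℝ≥0∞ :=
  ∫⁻ t in Ioi (0 : ℝ),
    sobolevNorm 3 (transport (velocity σ (linearFlow μ α Θ₀ t)) (linearFlow μ α Θ₀ t))

/-- The smallness condition
`(‖g₀‖²_{H³} + ∫₀^∞ ‖U·∇Θ‖_{H³} dt) exp(C(∫₀^∞ ‖U,Θ‖_{L^∞} dt + ∫₀^∞ ‖U·∇Θ‖_{H³} dt)) ≤ ε`,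
all the quantities in it being finite. -/
def SmallnessCondition (C ε μ α σ : ℝ) (Θ₀ g₀ : Plane → ℝ) : Prop :=
  sobolevNorm 3 g₀ ≠ ⊤ ∧ supIntegral μ α σ Θ₀ ≠ ⊤ ∧ transportIntegral μ α σ Θ₀ ≠ ⊤ ∧
    ((sobolevNorm 3 g₀).toReal ^ 2 + (transportIntegral μ α σ Θ₀).toReal) *
      Real.exp (C * ((supIntegral μ α σ Θ₀).toReal + (transportIntegral μ α σ Θ₀).toReal)) ≤ ε

/-- The part `|ξ₁ - ξ₂| ≤ w` of the annulus `4/3 ≤ |ξ| ≤ 3/2`. -/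
def strip (w : ℝ) : Set Plane :=
  {ξ | |ξ 0 - ξ 1| ≤ w ∧ 4 / 3 ≤ ‖ξ‖ ∧ ‖ξ‖ ≤ 3 / 2}

/-- `χ` is smooth and square integrable, and `χ̂` is an even cut-off function (real, with values in
`[0, 1]`) that equals `1` on the strip of parameter `δ/3` and is supported in the strip of
parameter `δ`. As `χ̂ ∈ L²`, these conditions are understood almost everywhere. -/
structure IsStripCutoff (δ : ℝ) (χ : Plane → ℝ) : Prop where
  smooth : ContDiff ℝ ∞ χ
  memLp : MemLp χ 2 (volume : Measure Plane)
  even : ∀ᵐ ξ : Plane, hat χ (-ξ) = hat χ ξ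
  cutoff : ∀ᵐ ξ : Plane, (hat χ ξ).im = 0 ∧ 0 ≤ (hat χ ξ).re ∧ (hat χ ξ).re ≤ 1
  eq_one : ∀ᵐ ξ : Plane, ξ ∈ strip (δ / 3) → hat χ ξ = 1
  eq_zero : ∀ᵐ ξ : Plane, ξ ∉ strip δ → hat χ ξ = 0

/-- The initial temperature `δ⁻¹ (log |log δ|) χ`. -/
def initialTemp (δ : ℝ) (χ : Plane → ℝ) (x : Plane) : ℝ :=
  δ⁻¹ * Real.log |Real.log δ| * χ x

end SQG

end

noncomputable section

namespace SQG

open Complex ComplexConjugate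

/-! ### The inverse Fourier transform on `L¹ ∩ L²` -/

section General

variable {V : Type*} [NormedAddCommGroup V] [InnerProductSpace ℝ V] [FiniteDimensional ℝ V]
  [MeasurableSpace V] [BorelSpace V]

/-! Write `L = log |log δ|` and `a = δ⁻¹ L`. The data have Fourier transform of height at most `a`
on a strip of area comparable to `δ`, so their sup norms are of order `a δ = L` and their `L²` norms
of order `a δ^(1/2) = δ^(-1/2) L`: both are large.

The transport term is nevertheless small. Its Fourier transform at `ζ` is an integral of the cross
product of `ξ` and `ζ - ξ` (`transportSymbol_eq_integral`). Both frequencies lie in the strip, hence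
are nearly parallel to `(1, 1)`, and the cross product is `O(δ)`. Together with the area of the
strip this gives a symbol of size `δ² a² = L²` (`norm_transportSymbol_le`), supported in a bounded
band of area `O(δ)`. Its `H³` norm is therefore `O(δ^(1/2) L²)` (`sobolevNorm_transport_le`).

All frequencies have length at least `4/3`, so the linear flow decays like `e^(-μt)` uniformly in
`α` (`isAmplitude_flow`), and the time integrals cost only a factor `1/μ`. The exponential in the
smallness condition is then at most a constant times `|log δ|^(7/4)`. The target `δ^(1/2) |log δ|²`
leaves a factor `|log δ|^(1/4)`, which absorbs every power of `L` (`smallness_real`).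

The lower bounds come from evaluating at a point where the Fourier integrand has one sign, and from
Plancherel. Everything is computed on symbols: `hat_re_synth` and `exists_profile` pass between
functions and everywhere defined Fourier transforms. -/

theorem integral_mul_fourierInv {F G : V → ℂ} (hF : Integrable F) (hG : Integrable G) :
    ∫ x, F x * 𝓕⁻ G x = ∫ x, 𝓕⁻ F x * G x := by
  have h := VectorFourier.integral_fourierIntegral_smul_eq_flip (e := Real.fourierChar)
    (μ := (volume : Measure V)) (ν := (volume : Measure V)) (L := -innerₗ V) (f := F) (g := G)
    Real.continuous_fourierChar (by simpa using! continuous_inner.neg) hF hG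
  have hflip : (-innerₗ V).flip = -innerₗ V := by
    ext v w
    simp [real_inner_comm]
  rw [hflip] at h
  exact h.symm

theorem continuous_fourierInv {G : V → ℂ} (hG : Integrable G) : Continuous (𝓕⁻ G) :=
  VectorFourier.fourierIntegral_continuous (L := -innerₗ V) Real.continuous_fourierChar
    (by simpa using! continuous_inner.neg) hG

/-- On `L¹ ∩ L²` the Plancherel extension of the inverse Fourier transform is given by the
integral. -/
theorem fourierInv_toLp_ae_eq {G : V → ℂ} (h1 : Integrable G) (h2 : MemLp G 2) :
    ((𝓕⁻ (h2.toLp G) : Lp ℂ 2 (volume : Measure V)) : V → ℂ) =ᵐ[volume] 𝓕⁻ G := by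
  -- Both sides are locally integrable, so it suffices to test against smooth compactly supported
  -- functions. These are Schwartz, and the transform can be moved onto them on either side.
  refine ae_eq_of_integral_contDiff_smul_eq ?_ ?_ ?_
  · exact (Lp.memLp _).locallyIntegrable (by norm_num)
  · exact (continuous_fourierInv h1).locallyIntegrable
  intro g hg hgc
  have hgc' : HasCompactSupport (fun x => (g x : ℂ)) := hgc.comp_left (g := ((↑) : ℝ → ℂ)) rfl
  have hg' : ContDiff ℝ ∞ (fun x => (g x : ℂ)) := Complex.ofRealCLM.contDiff.comp hg
  have key := congrArg (fun T => T (hgc'.toSchwartzMap hg'))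
    (Lp.fourierInv_toTemperedDistribution_eq (h2.toLp G))
  simp only [TemperedDistribution.fourierInv_apply, Lp.toTemperedDistribution_apply,
    SchwartzMap.fourierInv_coe] at key
  have hcoe : ∀ x, hgc'.toSchwartzMap hg' x = (g x : ℂ) := fun x => rfl
  have hfun : (⇑(hgc'.toSchwartzMap hg') : V → ℂ) = fun x => (g x : ℂ) := rfl
  calc ∫ x, g x • (𝓕⁻ (h2.toLp G) : Lp ℂ 2 (volume : Measure V)) x
      = ∫ x, hgc'.toSchwartzMap hg' x • (𝓕⁻ (h2.toLp G) : Lp ℂ 2 (volume : Measure V)) x := by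
        simp only [hcoe, Complex.real_smul, smul_eq_mul]
    _ = ∫ x, 𝓕⁻ (⇑(hgc'.toSchwartzMap hg')) x • h2.toLp G x := key.symm
    _ = ∫ x, G x * 𝓕⁻ (fun x => (g x : ℂ)) x := by
        refine integral_congr_ae ?_
        filter_upwards [h2.coeFn_toLp] with x hx
        rw [hx, hfun, smul_eq_mul, mul_comm]
    _ = ∫ x, 𝓕⁻ G x * (g x : ℂ) :=
        integral_mul_fourierInv h1 (hg'.continuous.integrable_of_hasCompactSupport hgc')
    _ = ∫ x, g x • 𝓕⁻ G x := by simp only [Complex.real_smul, mul_comm]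

end General

/-! ### Band-limited functions -/

/-- The function `x ↦ (2π)⁻² ∫ e^{i x·ξ} G(ξ) dξ` with Fourier transform `G`. -/
def synth (G : Plane → ℂ) (x : Plane) : ℂ :=
  (((2 * Real.pi) ^ 2)⁻¹ : ℝ) * ∫ ξ : Plane, Complex.exp (Complex.I * (inner ℝ x ξ : ℝ)) * G ξ

theorem synth_congr_ae {F G : Plane → ℂ} (h : F =ᵐ[volume] G) : synth F = synth G := by
  funext x
  unfold synth
  congr 1
  refine integral_congr_ae ?_
  filter_upwards [h] with ξ hξ
  rw [hξ]

/-- The substitution `ξ = 2π η` has Jacobian `(2π)²` in the plane, which cancels the prefactor. -/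
theorem synth_eq_fourierInv (G : Plane → ℂ) (x : Plane) :
    synth G x = 𝓕⁻ (fun η : Plane => G ((2 * Real.pi) • η)) x := by
  have hpi : 0 < 2 * Real.pi := by positivity
  rw [Real.fourierInv_eq']
  have h := Measure.integral_comp_smul (volume : Measure Plane)
    (fun ξ : Plane => Complex.exp (Complex.I * (inner ℝ x ξ : ℝ)) * G ξ) (2 * Real.pi)
  rw [finrank_euclideanSpace, Fintype.card_fin, abs_of_pos (by positivity), Complex.real_smul] at h
  rw [synth, ← h]
  refine integral_congr_ae (Filter.Eventually.of_forall fun η => ?_)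
  simp only [smul_eq_mul, inner_smul_right, real_inner_comm x η]
  rw [mul_comm Complex.I]

theorem norm_re_synth_le (G : Plane → ℂ) (x : Plane) :
    ‖(synth G x).re‖ ≤ ((2 * Real.pi) ^ 2)⁻¹ * ∫ ξ, ‖G ξ‖ := by
  refine (Complex.abs_re_le_norm _).trans ?_
  unfold synth
  rw [norm_mul, Complex.norm_real, Real.norm_eq_abs, abs_of_pos (by positivity)]
  gcongr
  refine (norm_integral_le_integral_norm _).trans (le_of_eq ?_)
  congr 1
  funext ξ
  rw [norm_mul, mul_comm Complex.I, Complex.norm_exp_ofReal_mul_I, one_mul]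

/-- Carries almost-everywhere identities through the rescaling of frequency between the two Fourier
normalisations. -/
theorem quasiMeasurePreserving_dilate {r : ℝ} (hr : r ≠ 0) :
    Measure.QuasiMeasurePreserving (fun ξ : Plane => r • ξ) :=
  ⟨measurable_const_smul _, by
    rw [Measure.map_addHaar_smul _ hr]
    exact Measure.smul_absolutelyContinuous⟩

/-- Bounded measurable functions of bounded support with the symmetry of the Fourier transform of a
real function. -/
structure IsSymbol (G : Plane → ℂ) : Prop where
  measurable : Measurable G
  bounded : ∃ M, ∀ ξ, ‖G ξ‖ ≤ M
  support : ∃ R, ∀ ξ, R < ‖ξ‖ → G ξ = 0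
  symm : ∀ ξ, G (-ξ) = conj (G ξ)

namespace IsSymbol

variable {F G : Plane → ℂ}

theorem memLp (hG : IsSymbol G) (p : ℝ≥0∞) : MemLp G p volume := by
  obtain ⟨M, hM⟩ := hG.bounded
  obtain ⟨R, hR⟩ := hG.support
  have hind : G = (Metric.closedBall (0 : Plane) R).indicator G := by
    funext ξ
    by_cases h : ξ ∈ Metric.closedBall (0 : Plane) R
    · rw [indicator_of_mem h]
    · rw [indicator_of_notMem h]
      exact hR ξ (by simpa using h)
  rw [hind, memLp_indicator_iff_restrict measurableSet_closedBall]
  have : IsFiniteMeasure (volume.restrict (Metric.closedBall (0 : Plane) R)) :=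
    ⟨by rw [Measure.restrict_apply_univ]; exact measure_closedBall_lt_top⟩
  exact MemLp.of_bound hG.measurable.aestronglyMeasurable M (Filter.Eventually.of_forall hM)

theorem integrable (hG : IsSymbol G) : Integrable G := memLp_one_iff_integrable.1 (hG.memLp 1)

/-- The bound on `m` is asked only where `G` does not vanish: this admits `‖ξ‖⁻¹`, singular at the
origin, for symbols supported in the annulus. -/
theorem mul_of_symm {m : Plane → ℂ} (hG : IsSymbol G) (hm : Measurable m)
    (hb : ∀ R, ∃ M, ∀ ξ, ‖ξ‖ ≤ R → G ξ ≠ 0 → ‖m ξ‖ ≤ M) (hs : ∀ ξ, m (-ξ) = conj (m ξ)) :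
    IsSymbol (fun ξ => m ξ * G ξ) where
  measurable := hm.mul hG.measurable
  bounded := by
    obtain ⟨M, hM⟩ := hG.bounded
    obtain ⟨R, hR⟩ := hG.support
    obtain ⟨M', hM'⟩ := hb R
    refine ⟨max M' 0 * max M 0, fun ξ => ?_⟩
    by_cases h0 : G ξ = 0
    · simp only [h0, mul_zero, norm_zero]
      positivity
    · rw [norm_mul]
      gcongr
      · exact (hM' ξ (not_lt.1 fun h => h0 (hR ξ h)) h0).trans (le_max_left _ _)
      · exact (hM ξ).trans (le_max_left _ _)
  support := by
    obtain ⟨R, hR⟩ := hG.support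
    exact ⟨R, fun ξ h => by simp [hR ξ h]⟩
  symm ξ := by rw [hs, hG.symm, map_mul]

theorem coord_mul (hG : IsSymbol G) (i : Fin 2) :
    IsSymbol (fun ξ => Complex.I * (ξ i : ℂ) * G ξ) := by
  refine hG.mul_of_symm (m := fun ξ => Complex.I * (ξ i : ℂ)) (by fun_prop)
    (fun R => ⟨R, fun ξ h _ => ?_⟩) (fun ξ => by simp)
  rw [norm_mul, Complex.norm_I, one_mul, Complex.norm_real]
  exact (PiLp.norm_apply_le ξ i).trans h

theorem dilate (hG : IsSymbol G) : IsSymbol (fun η => G ((2 * Real.pi) • η)) where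
  measurable := hG.measurable.comp (measurable_const_smul _)
  bounded := by
    obtain ⟨M, hM⟩ := hG.bounded
    exact ⟨M, fun ξ => hM _⟩
  support := by
    obtain ⟨R, hR⟩ := hG.support
    refine ⟨(2 * Real.pi)⁻¹ * R, fun ξ h => hR _ ?_⟩
    have hpi : 0 < 2 * Real.pi := by positivity
    rw [norm_smul, Real.norm_eq_abs, abs_of_pos hpi]
    rwa [inv_mul_lt_iff₀ hpi] at h
  symm ξ := by rw [smul_neg, hG.symm]

/-- Conjugation amounts to `ξ ↦ -ξ` under the integral, by the symmetry of `G`. Hence taking real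
parts of `synth G` loses nothing. -/
theorem conj_synth (hG : IsSymbol G) (x : Plane) : conj (synth G x) = synth G x := by
  unfold synth
  rw [map_mul, Complex.conj_ofReal, ← integral_conj]
  congr 1
  rw [← integral_neg_eq_self]
  refine integral_congr_ae (Filter.Eventually.of_forall fun ξ => ?_)
  simp only [map_mul, hG.symm, ← Complex.exp_conj, Complex.conj_I, Complex.conj_ofReal,
    Complex.conj_conj, inner_neg_right, Complex.ofReal_neg, map_neg, neg_mul_neg]

theorem ofReal_re_synth (hG : IsSymbol G) (x : Plane) : ((synth G x).re : ℂ) = synth G x :=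
  Complex.conj_eq_iff_re.1 (hG.conj_synth x)

theorem integrable_exp_mul (hG : IsSymbol G) (x : Plane) :
    Integrable (fun ξ : Plane => Complex.exp (Complex.I * (inner ℝ x ξ : ℝ)) * G ξ) := by
  refine hG.integrable.bdd_mul (c := 1) (by fun_prop) (Filter.Eventually.of_forall fun ξ => ?_)
  rw [mul_comm, Complex.norm_exp_ofReal_mul_I]

/-- Bounded support makes every moment of `G` integrable; no regularity of `G` is needed. -/
theorem contDiff_synth (hG : IsSymbol G) : ContDiff ℝ ∞ (synth G) := by
  have h : synth G = fun x => 𝓕 (fun η : Plane => G ((2 * Real.pi) • η)) (-x) := by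
    funext x
    rw [synth_eq_fourierInv, Real.fourierInv_eq_fourier_neg]
  rw [h]
  refine (Real.contDiff_fourier (N := ⊤) fun n _ => ?_).comp contDiff_neg
  obtain ⟨R, hR⟩ := hG.dilate.support
  refine (hG.dilate.integrable.norm.const_mul (|R| ^ n)).mono'
    ((by fun_prop : Measurable fun v : Plane => ‖v‖ ^ n).mul
      hG.dilate.measurable.norm).aestronglyMeasurable (Filter.Eventually.of_forall fun ξ => ?_)
  by_cases h : R < ‖ξ‖
  · simp [hR ξ h]
  · rw [norm_mul, norm_norm, norm_pow, norm_norm]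
    gcongr
    exact (not_lt.1 h).trans (le_abs_self R)

theorem contDiff_re_synth (hG : IsSymbol G) : ContDiff ℝ ∞ (fun x => (synth G x).re) :=
  Complex.reCLM.contDiff.comp hG.contDiff_synth

theorem continuous_re_synth (hG : IsSymbol G) : Continuous (fun x => (synth G x).re) :=
  hG.contDiff_re_synth.continuous

theorem ofReal_re_synth_ae_eq (hG : IsSymbol G) :
    (fun x => ((synth G x).re : ℂ)) =ᵐ[volume]
      (𝓕⁻ ((hG.dilate.memLp 2).toLp _) : Lp ℂ 2 (volume : Measure Plane)) := by
  filter_upwards [fourierInv_toLp_ae_eq hG.dilate.integrable (hG.dilate.memLp 2)] with x hx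
  rw [hx, hG.ofReal_re_synth, synth_eq_fourierInv]

theorem memLp_ofReal_re_synth (hG : IsSymbol G) :
    MemLp (fun x => ((synth G x).re : ℂ)) 2 (volume : Measure Plane) :=
  (memLp_congr_ae hG.ofReal_re_synth_ae_eq).2 (Lp.memLp _)

theorem memLp_re_synth (hG : IsSymbol G) : MemLp (fun x => (synth G x).re) 2 volume :=
  hG.memLp_ofReal_re_synth.re

theorem toLp_ofReal_re_synth (hG : IsSymbol G) :
    hG.memLp_ofReal_re_synth.toLp _ = 𝓕⁻ ((hG.dilate.memLp 2).toLp _) :=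
  Lp.ext (hG.memLp_ofReal_re_synth.coeFn_toLp.trans hG.ofReal_re_synth_ae_eq)

/-- Plancherel inversion. It allows `multiplier` and `sobolevNorm`, both defined through `hat`, to
be computed on symbols. -/
theorem hat_re_synth (hG : IsSymbol G) : hat (fun x => (synth G x).re) =ᵐ[volume] G := by
  have hpi : (2 * Real.pi)⁻¹ ≠ 0 := by positivity
  unfold hat
  rw [dif_pos hG.memLp_ofReal_re_synth]
  have h1 : ((𝓕 (hG.memLp_ofReal_re_synth.toLp _) : Lp ℂ 2 (volume : Measure Plane)) :
      Plane → ℂ) =ᵐ[volume] fun η => G ((2 * Real.pi) • η) := by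
    rw [hG.toLp_ofReal_re_synth, FourierTransform.fourier_fourierInv_eq]
    exact MemLp.coeFn_toLp _
  filter_upwards [(quasiMeasurePreserving_dilate hpi).ae h1] with ξ hξ
  rw [hξ, smul_inv_smul₀ (by positivity)]

end IsSymbol

/-! ### Operations on symbols: linear combinations, multipliers, derivatives and products -/

theorem synth_add {F G : Plane → ℂ} (hF : IsSymbol F) (hG : IsSymbol G) (x : Plane) :
    synth (fun ξ => F ξ + G ξ) x = synth F x + synth G x := by
  simp only [synth, mul_add]
  rw [integral_add (hF.integrable_exp_mul x) (hG.integrable_exp_mul x), mul_add]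

theorem synth_const_mul (c : ℂ) (G : Plane → ℂ) (x : Plane) :
    synth (fun ξ => c * G ξ) x = c * synth G x := by
  simp only [synth]
  rw [mul_left_comm, ← integral_const_mul c]
  congr 2
  funext ξ
  ring

theorem multiplier_eq_re_synth (m f : Plane → ℝ) :
    multiplier m f = fun x => (synth (fun ξ => (m ξ : ℂ) * hat f ξ) x).re := by
  funext x
  simp only [multiplier, synth, Complex.re_ofReal_mul, mul_assoc]

theorem measurable_hat (f : Plane → ℝ) : Measurable (hat f) := by
  unfold hat
  split_ifs with h
  · exact (Lp.stronglyMeasurable _).measurable.comp (measurable_const_smul _)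
  · exact measurable_const

/-- The convolution `(2π)⁻² F ⋆ G`, the Fourier transform of a product. -/
def symbolConv (F G : Plane → ℂ) (ζ : Plane) : ℂ :=
  (((2 * Real.pi) ^ 2)⁻¹ : ℝ) * ∫ ξ : Plane, F ξ * G (ζ - ξ)

namespace IsSymbol

variable {F G : Plane → ℂ}

theorem add (hF : IsSymbol F) (hG : IsSymbol G) : IsSymbol (fun ξ => F ξ + G ξ) where
  measurable := hF.measurable.add hG.measurable
  bounded := by
    obtain ⟨M, hM⟩ := hF.bounded
    obtain ⟨M', hM'⟩ := hG.bounded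
    exact ⟨M + M', fun ξ => (norm_add_le _ _).trans (add_le_add (hM ξ) (hM' ξ))⟩
  support := by
    obtain ⟨R, hR⟩ := hF.support
    obtain ⟨R', hR'⟩ := hG.support
    exact ⟨max R R', fun ξ h => by
      rw [hR ξ ((le_max_left _ _).trans_lt h), hR' ξ ((le_max_right _ _).trans_lt h), add_zero]⟩
  symm ξ := by rw [hF.symm, hG.symm, map_add]

theorem const_mul (c : ℝ) (hG : IsSymbol G) : IsSymbol (fun ξ => (c : ℂ) * G ξ) :=
  hG.mul_of_symm (m := fun _ => (c : ℂ)) measurable_const (fun _ => ⟨|c|, by simp⟩) (by simp)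

theorem multiplier_re_synth (hG : IsSymbol G) (m : Plane → ℝ) :
    multiplier m (fun x => (synth G x).re) = fun x => (synth (fun ξ => (m ξ : ℂ) * G ξ) x).re := by
  rw [multiplier_eq_re_synth, synth_congr_ae]
  filter_upwards [hG.hat_re_synth] with ξ hξ
  rw [hξ]

theorem partialDeriv_re_synth (hG : IsSymbol G) (i : Fin 2) :
    partialDeriv i (fun x => (synth G x).re) =
      fun x => (synth (fun ξ => Complex.I * (ξ i : ℂ) * G ξ) x).re := by
  funext x
  set D : Plane → ℂ := fun η => G ((2 * Real.pi) • η)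
  have hDint : Integrable (fun v => ‖v‖ * ‖D v‖) := by
    obtain ⟨R, hR⟩ := hG.dilate.support
    refine (hG.dilate.integrable.norm.const_mul |R|).mono'
      (measurable_norm.mul hG.dilate.measurable.norm).aestronglyMeasurable
      (Filter.Eventually.of_forall fun ξ => ?_)
    by_cases h : R < ‖ξ‖
    · simp [D, hR ξ h]
    · rw [norm_mul, norm_norm, norm_norm]
      gcongr
      exact (not_lt.1 h).trans (le_abs_self R)
  have hfun : synth G = fun x => 𝓕 D (-x) := by
    funext x
    rw [synth_eq_fourierInv, Real.fourierInv_eq_fourier_neg]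
  have h1 := Real.hasFDerivAt_fourier hG.dilate.integrable hDint (-x)
  have h2 := h1.comp x (hasFDerivAt_id x).neg
  have h3 := (Complex.reCLM.hasFDerivAt (x := 𝓕 D (-x))).comp x h2
  unfold partialDeriv
  have h4 : (fun x => (synth G x).re) = Complex.reCLM ∘ 𝓕 D ∘ fun x => -x := by
    rw [hfun]
    rfl
  rw [h4, h3.fderiv]
  simp only [ContinuousLinearMap.comp_apply, _root_.neg_apply,
    ContinuousLinearMap.id_apply, Complex.reCLM_apply, map_neg]
  rw [← Complex.neg_re]
  congr 1
  have hinteg : Integrable (VectorFourier.fourierSMulRight (innerSL ℝ) D) := by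
    refine (hDint.const_mul (2 * Real.pi * ‖innerSL ℝ (E := Plane)‖)).mono'
      hG.dilate.integrable.aestronglyMeasurable.fourierSMulRight
      (Filter.Eventually.of_forall fun ξ => ?_)
    refine (VectorFourier.norm_fourierSMulRight_le _ _ _).trans (le_of_eq ?_)
    ring
  rw [Real.fourier_continuousLinearMap_apply hinteg, synth_eq_fourierInv,
    Real.fourierInv_eq_fourier_neg, Real.fourier_eq, Real.fourier_eq, ← integral_neg]
  congr 1
  funext v
  rw [← smul_neg, VectorFourier.fourierSMulRight_apply]
  congr 1
  have hinner : innerSL ℝ v (EuclideanSpace.single i (1 : ℝ)) = v i := by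
    rw [innerSL_apply_apply, EuclideanSpace.inner_single_right]
    simp
  rw [hinner]
  simp [D]
  ring

theorem fracLaplacian_re_synth (hG : IsSymbol G) (s : ℝ) :
    fracLaplacian s (fun x => (synth G x).re) =
      fun x => (synth (fun ξ => ((‖ξ‖ ^ (2 * s) : ℝ) : ℂ) * G ξ) x).re :=
  hG.multiplier_re_synth _

/-- Injectivity of the Plancherel transform gives equality almost everywhere; continuity of both
sides makes it hold everywhere. -/
theorem eq_re_synth_of_hat {f : Plane → ℝ} (hG : IsSymbol G) (hc : Continuous f)
    (h2 : MemLp f 2 volume) (h : hat f =ᵐ[volume] G) : f = fun x => (synth G x).re := by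
  have h2' : MemLp (fun x => (f x : ℂ)) 2 (volume : Measure Plane) := h2.ofReal
  have hpi : 2 * Real.pi ≠ 0 := by positivity
  have h3 : 𝓕 (h2'.toLp _) = (hG.dilate.memLp 2).toLp _ := by
    refine Lp.ext ?_
    refine Filter.EventuallyEq.trans ?_ (MemLp.coeFn_toLp _).symm
    filter_upwards [(quasiMeasurePreserving_dilate hpi).ae h] with η hη
    rw [← hη, hat, dif_pos h2', inv_smul_smul₀ hpi]
  have h4 : h2'.toLp _ = 𝓕⁻ ((hG.dilate.memLp 2).toLp _) := by
    rw [← h3, FourierTransform.fourierInv_fourier_eq]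
  refine (Continuous.ae_eq_iff_eq volume hc hG.continuous_re_synth).1 ?_
  filter_upwards [h2'.coeFn_toLp, hG.ofReal_re_synth_ae_eq] with x hx hx'
  rw [← h4, hx] at hx'
  exact_mod_cast hx'.symm

/-- A lower bound for the `L²` norm from Plancherel's identity. -/
theorem le_eLpNorm_two_re_synth (hG : IsSymbol G) {S : Set Plane} (hS : MeasurableSet S) {c : ℝ}
    (hc : 0 ≤ c) (h : ∀ ξ ∈ S, c ≤ ‖G ξ‖) :
    ENNReal.ofReal c * (ENNReal.ofReal ((2 * Real.pi) ^ 2)⁻¹ * volume S) ^ (1 / 2 : ℝ) ≤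
      eLpNorm (fun x => (synth G x).re) 2 volume := by
  have hpi : 2 * Real.pi ≠ 0 := by positivity
  have e1 : eLpNorm (fun x => (synth G x).re) 2 volume =
      eLpNorm (fun η => G ((2 * Real.pi) • η)) 2 volume := by
    rw [← Lp.enorm_toLp (hG.dilate.memLp 2), ← enorm_norm,
      ← (Lp.fourierTransformₗᵢ Plane ℂ).symm.norm_map, enorm_norm]
    change _ = ‖𝓕⁻ ((hG.dilate.memLp 2).toLp _)‖ₑ
    rw [← hG.toLp_ofReal_re_synth, Lp.enorm_toLp]
    refine eLpNorm_congr_norm_ae (Filter.Eventually.of_forall fun x => ?_)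
    rw [Complex.norm_real]
  set T : Set Plane := (fun η => (2 * Real.pi) • η) ⁻¹' S with hT
  have hTm : MeasurableSet T := measurable_const_smul _ hS
  have hvol : volume T = ENNReal.ofReal ((2 * Real.pi) ^ 2)⁻¹ * volume S := by
    rw [hT, Measure.addHaar_preimage_smul _ hpi, finrank_euclideanSpace, Fintype.card_fin,
      abs_of_pos (by positivity)]
  have e2 := eLpNorm_indicator_const (μ := (volume : Measure Plane)) (c := c) hTm
    (p := 2) (by norm_num) (by norm_num)
  rw [hvol, Real.enorm_of_nonneg hc, ENNReal.toReal_ofNat] at e2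
  rw [← e2, e1]
  refine eLpNorm_mono fun η => ?_
  by_cases hη : η ∈ T
  · rw [indicator_of_mem hη, Real.norm_of_nonneg hc]
    exact h _ hη
  · rw [indicator_of_notMem hη, norm_zero]
    exact norm_nonneg _

theorem conv (hF : IsSymbol F) (hG : IsSymbol G) : IsSymbol (symbolConv F G) where
  measurable := by
    refine Measurable.const_mul ?_ _
    have : StronglyMeasurable (fun p : Plane × Plane => F p.2 * G (p.1 - p.2)) :=
      ((hF.measurable.comp measurable_snd).mul
        (hG.measurable.comp (measurable_fst.sub measurable_snd))).stronglyMeasurable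
    exact this.integral_prod_right.measurable
  bounded := by
    obtain ⟨M, hM⟩ := hG.bounded
    refine ⟨((2 * Real.pi) ^ 2)⁻¹ * ∫ ξ, ‖F ξ‖ * M, fun ζ => ?_⟩
    rw [symbolConv, norm_mul, Complex.norm_real, Real.norm_of_nonneg (by positivity)]
    gcongr
    refine norm_integral_le_of_norm_le (hF.integrable.norm.mul_const M)
      (Filter.Eventually.of_forall fun ξ => ?_)
    rw [norm_mul]
    gcongr
    exact hM _
  support := by
    obtain ⟨R, hR⟩ := hF.support
    obtain ⟨R', hR'⟩ := hG.support
    refine ⟨R + R', fun ζ h => ?_⟩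
    rw [symbolConv, integral_eq_zero_of_ae, mul_zero]
    refine Filter.Eventually.of_forall fun ξ => ?_
    by_cases h1 : R < ‖ξ‖
    · simp [hR ξ h1]
    · have : R' < ‖ζ - ξ‖ := by
        have := norm_sub_norm_le ζ ξ
        linarith
      simp [hR' _ this]
  symm ζ := by
    rw [symbolConv, symbolConv, map_mul, Complex.conj_ofReal, ← integral_conj,
      ← integral_neg_eq_self]
    congr 2
    funext ξ
    rw [map_mul, ← hF.symm, ← hG.symm]
    congr 2
    abel

theorem integrable_mul_comp_sub (hF : IsSymbol F) (hG : IsSymbol G) (ζ : Plane) :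
    Integrable (fun ξ => F ξ * G (ζ - ξ)) := by
  obtain ⟨M, hM⟩ := hG.bounded
  exact hF.integrable.mul_bdd
    (hG.measurable.comp (measurable_const.sub measurable_id)).aestronglyMeasurable
    (Filter.Eventually.of_forall fun ξ => hM (ζ - ξ))

theorem synth_conv (hF : IsSymbol F) (hG : IsSymbol G) (x : Plane) :
    synth (symbolConv F G) x = synth F x * synth G x := by
  simp only [synth_eq_fourierInv, Real.fourierInv_eq_fourier_neg]
  rw [← Real.fourier_mul_convolution_eq hF.dilate.integrable hG.dilate.integrable]
  refine Real.fourier_congr_ae (Filter.Eventually.of_forall fun ζ => ?_) _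
  rw [convolution_def, symbolConv]
  have h := Measure.integral_comp_smul (volume : Measure Plane)
    (fun ξ : Plane => F ξ * G ((2 * Real.pi) • ζ - ξ)) (2 * Real.pi)
  rw [finrank_euclideanSpace, Fintype.card_fin, abs_of_pos (by positivity), Complex.real_smul] at h
  rw [← h]
  simp only [ContinuousLinearMap.mul_apply', smul_sub]

theorem re_synth_mul (hF : IsSymbol F) (hG : IsSymbol G) (x : Plane) :
    (synth F x).re * (synth G x).re = (synth (symbolConv F G) x).re := by
  rw [hF.synth_conv hG, ← hF.ofReal_re_synth x, ← hG.ofReal_re_synth x, ← Complex.ofReal_mul,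
    Complex.ofReal_re, Complex.ofReal_re, Complex.ofReal_re]

end IsSymbol

/-! ### Geometry of the strips -/

theorem norm_sq_eq_coords (ξ : Plane) : ‖ξ‖ ^ 2 = ξ 0 ^ 2 + ξ 1 ^ 2 := by
  rw [EuclideanSpace.real_norm_sq_eq, Fin.sum_univ_two]

/-- Fubini: for fixed `ξ 1 ∈ S` the section in `ξ 0` is an interval of length `2w`. -/
theorem volume_band (w : ℝ) {S : Set ℝ} (hS : MeasurableSet S) :
    volume {ξ : Plane | |ξ 0 - ξ 1| ≤ w ∧ ξ 1 ∈ S} = ENNReal.ofReal (2 * w) * volume S := by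
  have hmp := (volume_preserving_finTwoArrow ℝ).comp
    (EuclideanSpace.volume_preserving_symm_measurableEquiv_toLp (Fin 2))
  set A : Set (ℝ × ℝ) := {p | |p.1 - p.2| ≤ w ∧ p.2 ∈ S} with hA
  have hdiff : Measurable fun p : ℝ × ℝ => |p.1 - p.2| := by fun_prop
  have hAm : MeasurableSet A :=
    (measurableSet_le hdiff measurable_const).inter (measurable_snd hS)
  have hpre : {ξ : Plane | |ξ 0 - ξ 1| ≤ w ∧ ξ 1 ∈ S} =
      (MeasurableEquiv.finTwoArrow ∘ (MeasurableEquiv.toLp 2 (Fin 2 → ℝ)).symm) ⁻¹' A := rfl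
  rw [hpre, hmp.measure_preimage hAm.nullMeasurableSet, Measure.volume_eq_prod,
    Measure.prod_apply_symm hAm]
  have hsec : ∀ y : ℝ, volume ((fun x => (x, y)) ⁻¹' A) =
      S.indicator (fun _ => ENNReal.ofReal (2 * w)) y := by
    intro y
    by_cases hy : y ∈ S
    · have : (fun x => (x, y)) ⁻¹' A = Icc (y - w) (y + w) := by
        ext x
        simp only [hA, mem_preimage, mem_ofPred_eq, hy, and_true, abs_le, mem_Icc]
        constructor <;> rintro ⟨h1, h2⟩ <;> constructor <;> linarith
      rw [this, Real.volume_Icc, indicator_of_mem hy]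
      congr 1
      ring
    · have : (fun x => (x, y)) ⁻¹' A = ∅ := by
        ext x
        simp [hA, hy]
      rw [this, measure_empty, indicator_of_notMem hy]
  simp only [hsec]
  rw [lintegral_indicator hS, setLIntegral_const]

theorem measurableSet_strip (w : ℝ) : MeasurableSet (strip w) := by
  have hdiff : Measurable fun ξ : Plane => |ξ 0 - ξ 1| := by fun_prop
  exact (measurableSet_le hdiff measurable_const).inter
    ((measurableSet_le measurable_const measurable_norm).inter
      (measurableSet_le measurable_norm measurable_const))

theorem neg_mem_strip {w : ℝ} {ξ : Plane} : -ξ ∈ strip w ↔ ξ ∈ strip w := by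
  simp only [strip, mem_ofPred_eq, norm_neg, PiLp.neg_apply]
  rw [show -ξ 0 - -ξ 1 = -(ξ 0 - ξ 1) by ring, abs_neg]

theorem strip_subset_strip {v w : ℝ} (h : v ≤ w) : strip v ⊆ strip w :=
  fun _ hξ => ⟨hξ.1.trans h, hξ.2⟩

/-- The coordinates differ by at most `δ`, so `2 (ξ i)²` is `‖ξ‖² ∈ [16/9, 9/4]` up to `O(δ)`. The
constants are `√(8/9) ≈ 0.943` and `√(9/8) ≈ 1.061` with room for this error. -/
theorem abs_coord_mem_of_mem_strip {δ : ℝ} (hδ : δ ≤ 1 / 1000) {ξ : Plane} (hξ : ξ ∈ strip δ)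
    (i : Fin 2) : 94 / 100 ≤ |ξ i| ∧ |ξ i| ≤ 1063 / 1000 := by
  obtain ⟨h1, h2, h3⟩ := hξ
  have hn := norm_sq_eq_coords ξ
  have h2' : (16 : ℝ) / 9 ≤ ξ 0 ^ 2 + ξ 1 ^ 2 := by nlinarith
  have h3' : ξ 0 ^ 2 + ξ 1 ^ 2 ≤ 9 / 4 := by nlinarith [norm_nonneg ξ]
  have key : ∀ a b : ℝ, |a - b| ≤ δ → 16 / 9 ≤ a ^ 2 + b ^ 2 → a ^ 2 + b ^ 2 ≤ 9 / 4 →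
      94 / 100 ≤ |a| ∧ |a| ≤ 1063 / 1000 := by
    intro a b hab hl hu
    have e1 : |b| ≤ |a| + 1 / 1000 := by
      have := abs_sub_abs_le_abs_sub b a
      rw [abs_sub_comm] at this
      linarith
    have e2 : |a| ≤ |b| + 1 / 1000 := by
      have := abs_sub_abs_le_abs_sub a b
      linarith
    have := sq_abs a
    have := sq_abs b
    have := abs_nonneg a
    have := abs_nonneg b
    constructor
    · by_contra! h
      nlinarith
    · by_contra! h
      nlinarith
  fin_cases i
  · exact key _ _ h1 h2' h3'
  · exact key (ξ 1) (ξ 0) (by rwa [abs_sub_comm]) (by linarith) (by linarith)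

theorem volume_strip_le {δ : ℝ} (hδ0 : 0 < δ) (hδ : δ ≤ 1 / 1000) :
    volume (strip δ) ≤ ENNReal.ofReal (δ / 2) := by
  set S : Set ℝ := Icc (94 / 100) (1063 / 1000) ∪ Icc (-(1063 / 1000)) (-(94 / 100)) with hS
  have hsub : strip δ ⊆ {ξ : Plane | |ξ 0 - ξ 1| ≤ δ ∧ ξ 1 ∈ S} := by
    intro ξ hξ
    refine ⟨hξ.1, ?_⟩
    obtain ⟨h1, h2⟩ := abs_coord_mem_of_mem_strip hδ hξ 1
    rcases abs_cases (ξ 1) with ⟨h, _⟩ | ⟨h, _⟩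
    · left
      constructor <;> linarith
    · right
      constructor <;> linarith
  have hvS : volume S ≤ ENNReal.ofReal (246 / 1000) := by
    refine (measure_union_le _ _).trans (le_of_eq ?_)
    rw [Real.volume_Icc, Real.volume_Icc, ← ENNReal.ofReal_add (by norm_num) (by norm_num)]
    norm_num
  refine (measure_mono hsub).trans ?_
  rw [volume_band _ (measurableSet_Icc.union measurableSet_Icc)]
  refine (mul_le_mul_right hvS _).trans ?_
  rw [← ENNReal.ofReal_mul (by positivity)]
  exact ENNReal.ofReal_le_ofReal (by linarith)

theorem le_volume_strip {δ : ℝ} (hδ0 : 0 < δ) (hδ : δ ≤ 1 / 1000) :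
    ENNReal.ofReal (δ / 20) ≤ volume (strip (δ / 3)) := by
  -- One of the two components suffices: a band of length `1/10` has area `δ/15 ≥ δ/20`.
  have hsub : {ξ : Plane | |ξ 0 - ξ 1| ≤ δ / 3 ∧ ξ 1 ∈ Icc (95 / 100 : ℝ) (105 / 100)} ⊆
      strip (δ / 3) := by
    rintro ξ ⟨h, h1, h2⟩
    have hn := norm_sq_eq_coords ξ
    obtain ⟨h3, h4⟩ := abs_le.1 h
    have hpos := norm_nonneg ξ
    refine ⟨h, ?_, ?_⟩
    · refine (sq_le_sq₀ (by norm_num) hpos).1 ?_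
      nlinarith
    · refine (sq_le_sq₀ hpos (by norm_num)).1 ?_
      nlinarith
  refine le_trans ?_ (measure_mono hsub)
  rw [volume_band _ measurableSet_Icc, Real.volume_Icc, ← ENNReal.ofReal_mul (by positivity)]
  exact ENNReal.ofReal_le_ofReal (by linarith)

/-! ### Profiles -/

/-- Everywhere defined versions of the cut-off functions of `IsStripCutoff`. -/
structure IsProfile (δ : ℝ) (X : Plane → ℝ) : Prop where
  measurable : Measurable X
  even : ∀ ξ, X (-ξ) = X ξ
  nonneg : ∀ ξ, 0 ≤ X ξ
  le_one : ∀ ξ, X ξ ≤ 1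
  eq_one : ∀ ξ ∈ strip (δ / 3), X ξ = 1
  eq_zero : ∀ ξ, ξ ∉ strip δ → X ξ = 0

theorem IsProfile.isSymbol {δ : ℝ} {X : Plane → ℝ} (hX : IsProfile δ X) :
    IsSymbol (fun ξ => (X ξ : ℂ)) where
  measurable := Complex.measurable_ofReal.comp hX.measurable
  bounded := ⟨1, fun ξ => by
    rw [Complex.norm_real, Real.norm_of_nonneg (hX.nonneg ξ)]
    exact hX.le_one ξ⟩
  support := ⟨3 / 2, fun ξ h => by
    rw [hX.eq_zero ξ fun hm => absurd hm.2.2 (not_le.2 h), Complex.ofReal_zero]⟩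
  symm ξ := by rw [hX.even, Complex.conj_ofReal]

open Classical in
theorem IsStripCutoff.exists_profile {δ : ℝ} (hδ : 0 < δ) {χ : Plane → ℝ}
    (h : IsStripCutoff δ χ) :
    ∃ X, IsProfile δ X ∧ χ = fun x => (synth (fun ξ => (X ξ : ℂ)) x).re := by
  have hm : Measurable fun ξ => (hat χ ξ).re := Complex.measurable_re.comp (measurable_hat χ)
  -- Averaging over `±ξ` and clamping to `[0, 1]` force evenness and the bounds at every point, and
  -- alter the real part of `hat χ` only on a null set.
  set Y : Plane → ℝ := fun ξ => max 0 (min 1 (((hat χ ξ).re + (hat χ (-ξ)).re) / 2)) with hY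
  have hYm : Measurable Y :=
    measurable_const.max (measurable_const.min ((hm.add (hm.comp measurable_neg)).div_const 2))
  set X : Plane → ℝ := fun ξ => if ξ ∈ strip (δ / 3) then 1 else if ξ ∈ strip δ then Y ξ else 0
    with hXdef
  have hX : IsProfile δ X :=
    { measurable := Measurable.ite (measurableSet_strip _) measurable_const
        (Measurable.ite (measurableSet_strip _) hYm measurable_const)
      even := fun ξ => by
        simp only [hXdef, neg_mem_strip, hY, neg_neg, add_comm]
      nonneg := fun ξ => by
        simp only [hXdef]
        split_ifs
        exacts [zero_le_one, le_max_left _ _, le_rfl]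
      le_one := fun ξ => by
        simp only [hXdef]
        split_ifs
        exacts [le_rfl, max_le zero_le_one (min_le_left _ _), zero_le_one]
      eq_one := fun ξ hξ => if_pos hξ
      eq_zero := fun ξ hξ => by
        simp only [hXdef]
        rw [if_neg fun h' => hξ (strip_subset_strip (by linarith) h'), if_neg hξ] }
  refine ⟨X, hX, hX.isSymbol.eq_re_synth_of_hat h.smooth.continuous h.memLp ?_⟩
  filter_upwards [h.even, h.cutoff, h.eq_one, h.eq_zero] with ξ h1 h2 h3 h4
  obtain ⟨hi, h0, h1'⟩ := h2
  simp only [hXdef]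
  split_ifs with hs hs'
  · rw [h3 hs, Complex.ofReal_one]
  · refine Complex.ext ?_ (by rw [hi, Complex.ofReal_im])
    rw [Complex.ofReal_re]
    simp only [hY, h1, add_self_div_two]
    rw [min_eq_right h1', max_eq_right h0]
  · rw [h4 hs', Complex.ofReal_zero]

/-- Conversely, every profile is the Fourier transform of a cut-off function. -/
theorem IsProfile.isStripCutoff {δ : ℝ} {X : Plane → ℝ} (hX : IsProfile δ X) :
    IsStripCutoff δ (fun x => (synth (fun ξ => (X ξ : ℂ)) x).re) := by
  have h := hX.isSymbol.hat_re_synth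
  refine ⟨hX.isSymbol.contDiff_re_synth, hX.isSymbol.memLp_re_synth, ?_, ?_, ?_, ?_⟩
  · filter_upwards [h, (Measure.measurePreserving_neg volume).quasiMeasurePreserving.ae h]
      with ξ h1 h2
    rw [h1, h2, hX.even]
  all_goals filter_upwards [h] with ξ h1; rw [h1]
  · exact ⟨Complex.ofReal_im _, hX.nonneg ξ, hX.le_one ξ⟩
  · exact fun hξ => by rw [hX.eq_one ξ hξ, Complex.ofReal_one]
  · exact fun hξ => by rw [hX.eq_zero ξ hξ, Complex.ofReal_zero]

/-- The witness that cut-offs exist. A discontinuous profile is allowed, since smoothness of `χ`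
needs only bounded frequency support. -/
theorem isProfile_indicator {δ : ℝ} (hδ : 0 < δ) : IsProfile δ ((strip δ).indicator 1) where
  measurable := measurable_one.indicator (measurableSet_strip δ)
  even ξ := by
    by_cases h : ξ ∈ strip δ
    · rw [indicator_of_mem h, indicator_of_mem (neg_mem_strip.2 h)]
      rfl
    · rw [indicator_of_notMem h, indicator_of_notMem fun h' => h (neg_mem_strip.1 h')]
  nonneg := indicator_nonneg fun _ _ => zero_le_one
  le_one := indicator_le_self' fun _ _ => zero_le_one
  eq_one ξ hξ := by rw [indicator_of_mem (strip_subset_strip (by linarith) hξ)]; rfl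
  eq_zero ξ hξ := indicator_of_notMem hξ 1

/-! ### Integrals over the strips -/

theorem inv_two_pi_sq_mem : (1 / 40 : ℝ) ≤ ((2 * Real.pi) ^ 2)⁻¹ ∧
    ((2 * Real.pi) ^ 2)⁻¹ ≤ (1 / 39 : ℝ) := by
  have h1 := Real.pi_gt_d2
  have h2 := Real.pi_lt_d2
  rw [← one_div]
  constructor
  · exact one_div_le_one_div_of_le (by positivity) (by nlinarith)
  · exact one_div_le_one_div_of_le (by norm_num) (by nlinarith)

theorem integral_norm_le_of_strip {δ b : ℝ} (hδ0 : 0 < δ) (hδ : δ ≤ 1 / 1000) (hb0 : 0 ≤ b)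
    {f : Plane → ℂ} (hb : ∀ ξ ∈ strip δ, ‖f ξ‖ ≤ b) (h0 : ∀ ξ, ξ ∉ strip δ → f ξ = 0) :
    ∫ ξ, ‖f ξ‖ ≤ b * (δ / 2) := by
  have hv := volume_strip_le hδ0 hδ
  have hvf : volume (strip δ) ≠ ⊤ := (hv.trans_lt ENNReal.ofReal_lt_top).ne
  calc ∫ ξ, ‖f ξ‖ ≤ ∫ ξ, (strip δ).indicator (fun _ => b) ξ := by
        refine integral_mono_of_nonneg (Filter.Eventually.of_forall fun _ => norm_nonneg _)
          ((integrableOn_const hvf).integrable_indicator (measurableSet_strip δ))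
          (Filter.Eventually.of_forall fun ξ => ?_)
        by_cases hξ : ξ ∈ strip δ
        · simpa [hξ] using hb ξ hξ
        · simp [hξ, h0 ξ hξ]
    _ = b * volume.real (strip δ) := by
        rw [integral_indicator_const _ (measurableSet_strip δ), smul_eq_mul, mul_comm]
    _ ≤ b * (δ / 2) := by
        gcongr
        exact ENNReal.toReal_le_of_le_ofReal (by positivity) hv

theorem le_integral_of_strip {δ c : ℝ} (hδ0 : 0 < δ) (hδ : δ ≤ 1 / 1000) (hc : 0 ≤ c)
    {f : Plane → ℝ} (hf : Integrable f) (h0 : ∀ ξ, 0 ≤ f ξ) (h : ∀ ξ ∈ strip (δ / 3), c ≤ f ξ) :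
    c * (δ / 20) ≤ ∫ ξ, f ξ := by
  have hvf : volume (strip (δ / 3)) ≠ ⊤ :=
    (((measure_mono (strip_subset_strip (by linarith))).trans (volume_strip_le hδ0 hδ)).trans_lt
      ENNReal.ofReal_lt_top).ne
  calc c * (δ / 20) ≤ c * volume.real (strip (δ / 3)) := by
        gcongr
        exact (ENNReal.ofReal_le_iff_le_toReal hvf).1 (le_volume_strip hδ0 hδ)
    _ = ∫ ξ, (strip (δ / 3)).indicator (fun _ => c) ξ := by
        rw [integral_indicator_const _ (measurableSet_strip _), smul_eq_mul, mul_comm]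
    _ ≤ ∫ ξ, f ξ := by
        refine integral_mono_of_nonneg
          (Filter.Eventually.of_forall fun ξ => indicator_nonneg (fun _ _ => hc) ξ) hf
          (Filter.Eventually.of_forall fun ξ => ?_)
        by_cases hξ : ξ ∈ strip (δ / 3)
        · simpa [hξ] using h ξ hξ
        · simpa [hξ] using h0 ξ

theorem abs_re_synth_le_of_strip {δ b : ℝ} (hδ0 : 0 < δ) (hδ : δ ≤ 1 / 1000) (hb0 : 0 ≤ b)
    {G : Plane → ℂ} (hb : ∀ ξ ∈ strip δ, ‖G ξ‖ ≤ b) (h0 : ∀ ξ, ξ ∉ strip δ → G ξ = 0)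
    (x : Plane) : |(synth G x).re| ≤ b * δ / 78 := by
  refine (norm_re_synth_le _ x).trans ?_
  calc ((2 * Real.pi) ^ 2)⁻¹ * ∫ ξ, ‖G ξ‖ ≤ 1 / 39 * (b * (δ / 2)) := by
        gcongr
        · exact inv_two_pi_sq_mem.2
        · exact integral_norm_le_of_strip hδ0 hδ hb0 hb h0
    _ = b * δ / 78 := by ring

theorem rpow_norm_mem_of_mem_strip {δ σ : ℝ} (hσ : σ ∈ ({-1 / 2, 1 / 2} : Set ℝ)) {ξ : Plane}
    (hξ : ξ ∈ strip δ) : 2 / 3 ≤ ‖ξ‖ ^ (2 * σ) ∧ ‖ξ‖ ^ (2 * σ) ≤ 3 / 2 := by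
  obtain ⟨-, h1, h2⟩ := hξ
  rcases hσ with rfl | rfl
  · rw [show 2 * (-1 / 2 : ℝ) = -1 by norm_num, Real.rpow_neg_one]
    constructor
    · rw [le_inv_comm₀ (by norm_num) (by linarith)]
      linarith
    · rw [inv_le_comm₀ (by linarith) (by norm_num)]
      linarith
  · rw [show 2 * (1 / 2 : ℝ) = 1 by norm_num, Real.rpow_one]
    constructor <;> linarith

/-- The set where a continuous function exceeds its essential supremum is open and null, hence
empty. -/
theorem ofReal_abs_le_eLpNorm_top_of_continuous {f : Plane → ℝ} (hf : Continuous f) (x : Plane) :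
    ENNReal.ofReal |f x| ≤ eLpNorm f ⊤ volume := by
  rw [← Real.enorm_eq_ofReal_abs]
  have hU : IsOpen {y | eLpNorm f ⊤ volume < ‖f y‖ₑ} :=
    isOpen_lt continuous_const hf.enorm
  have h0 : volume {y | eLpNorm f ⊤ volume < ‖f y‖ₑ} = 0 := by
    have := ae_le_eLpNormEssSup (f := f) (μ := (volume : Measure Plane))
    rw [← eLpNorm_exponent_top, ae_iff] at this
    simpa only [not_le] using this
  by_contra! h
  exact (hU.measure_pos volume ⟨x, h⟩).ne' h0

/-! ### Band-limited temperatures -/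

/-- Real even symbols supported in the strip, with values in `[0, a]`. -/
structure IsAmplitude (δ a : ℝ) (A : Plane → ℝ) : Prop where
  measurable : Measurable A
  even : ∀ ξ, A (-ξ) = A ξ
  nonneg : ∀ ξ, 0 ≤ A ξ
  le : ∀ ξ, A ξ ≤ a
  eq_zero : ∀ ξ, ξ ∉ strip δ → A ξ = 0

/-- The function with Fourier transform `A`. -/
def temp (A : Plane → ℝ) (x : Plane) : ℝ := (synth (fun ξ => (A ξ : ℂ)) x).re

/-- The symbol of `∂ᵢ (-Δ)^σ` applied to `temp A`. -/
def gradSymbol (σ : ℝ) (i : Fin 2) (A : Plane → ℝ) (ξ : Plane) : ℂ :=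
  Complex.I * (ξ i : ℂ) * (((‖ξ‖ ^ (2 * σ) : ℝ) : ℂ) * (A ξ : ℂ))

theorem norm_gradSymbol {σ : ℝ} {i : Fin 2} {A : Plane → ℝ} {ξ : Plane} (h : 0 ≤ A ξ) :
    ‖gradSymbol σ i A ξ‖ = |ξ i| * (‖ξ‖ ^ (2 * σ) * A ξ) := by
  rw [gradSymbol, norm_mul, norm_mul, norm_mul, Complex.norm_I, one_mul, Complex.norm_real,
    Complex.norm_real, Complex.norm_real, Real.norm_eq_abs, Real.norm_of_nonneg (by positivity),
    Real.norm_of_nonneg h]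

namespace IsAmplitude

variable {δ a : ℝ} {A : Plane → ℝ}

theorem isSymbol (hA : IsAmplitude δ a A) : IsSymbol (fun ξ => (A ξ : ℂ)) where
  measurable := Complex.measurable_ofReal.comp hA.measurable
  bounded := ⟨a, fun ξ => by
    rw [Complex.norm_real, Real.norm_of_nonneg (hA.nonneg ξ)]
    exact hA.le ξ⟩
  support := ⟨3 / 2, fun ξ h => by
    rw [hA.eq_zero ξ fun hm => absurd hm.2.2 (not_le.2 h), Complex.ofReal_zero]⟩
  symm ξ := by rw [hA.even, Complex.conj_ofReal]

theorem bound_nonneg (hA : IsAmplitude δ a A) : 0 ≤ a := (hA.nonneg 0).trans (hA.le 0)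

variable {σ : ℝ}

theorem isSymbol_rpow (hA : IsAmplitude δ a A) (hσ : σ ∈ ({-1 / 2, 1 / 2} : Set ℝ)) :
    IsSymbol (fun ξ => ((‖ξ‖ ^ (2 * σ) : ℝ) : ℂ) * (A ξ : ℂ)) := by
  refine hA.isSymbol.mul_of_symm (m := fun ξ => ((‖ξ‖ ^ (2 * σ) : ℝ) : ℂ))
    (Complex.measurable_ofReal.comp (measurable_norm.pow_const _))
    (fun _ => ⟨3 / 2, fun ξ _ h0 => ?_⟩) (fun ξ => by rw [norm_neg, Complex.conj_ofReal])
  have hξ : ξ ∈ strip δ := by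
    by_contra h
    exact h0 (by rw [hA.eq_zero ξ h, Complex.ofReal_zero])
  rw [Complex.norm_real, Real.norm_of_nonneg (by positivity)]
  exact (rpow_norm_mem_of_mem_strip hσ hξ).2

theorem isSymbol_gradSymbol (hA : IsAmplitude δ a A) (hσ : σ ∈ ({-1 / 2, 1 / 2} : Set ℝ))
    (i : Fin 2) : IsSymbol (gradSymbol σ i A) :=
  (hA.isSymbol_rpow hσ).coord_mul i

theorem partialDeriv_fracLaplacian_temp (hA : IsAmplitude δ a A)
    (hσ : σ ∈ ({-1 / 2, 1 / 2} : Set ℝ)) (i : Fin 2) :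
    partialDeriv i (fracLaplacian σ (temp A)) = fun x => (synth (gradSymbol σ i A) x).re := by
  unfold temp
  rw [hA.isSymbol.fracLaplacian_re_synth, (hA.isSymbol_rpow hσ).partialDeriv_re_synth]
  rfl

theorem velocity_temp (hA : IsAmplitude δ a A) (hσ : σ ∈ ({-1 / 2, 1 / 2} : Set ℝ)) (x : Plane) :
    velocity σ (temp A) x =
      !₂[(synth (gradSymbol σ 1 A) x).re, -(synth (gradSymbol σ 0 A) x).re] := by
  rw [velocity, hA.partialDeriv_fracLaplacian_temp hσ, hA.partialDeriv_fracLaplacian_temp hσ]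

theorem eLpNorm_top_temp_le (hA : IsAmplitude δ a A) (hδ0 : 0 < δ) (hδ : δ ≤ 1 / 1000) :
    eLpNorm (temp A) ⊤ volume ≤ ENNReal.ofReal (a * δ / 78) := by
  rw [eLpNorm_exponent_top]
  refine eLpNormEssSup_le_of_ae_bound (Filter.Eventually.of_forall fun x => ?_)
  refine abs_re_synth_le_of_strip hδ0 hδ hA.bound_nonneg (fun ξ _ => ?_) (fun ξ hξ => ?_) x
  · rw [Complex.norm_real, Real.norm_of_nonneg (hA.nonneg ξ)]
    exact hA.le ξ
  · rw [hA.eq_zero ξ hξ, Complex.ofReal_zero]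

theorem eLpNorm_top_velocity_le (hA : IsAmplitude δ a A) (hδ0 : 0 < δ) (hδ : δ ≤ 1 / 1000)
    (hσ : σ ∈ ({-1 / 2, 1 / 2} : Set ℝ)) :
    eLpNorm (velocity σ (temp A)) ⊤ volume ≤ ENNReal.ofReal (2256 / 1000 * (a * δ / 78)) := by
  have ha := hA.bound_nonneg
  -- `1.063 · 3/2 ≤ 1.595` bounds each component; the Euclidean norm of the pair then costs `√2`,
  -- and `1.595 √2 ≤ 2.256`.
  have hcomp : ∀ (i : Fin 2) (x : Plane),
      |(synth (gradSymbol σ i A) x).re| ≤ 1595 / 1000 * (a * δ / 78) := by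
    intro i x
    refine (abs_re_synth_le_of_strip hδ0 hδ (b := 1595 / 1000 * a) (by positivity)
      (fun ξ hξ => ?_) (fun ξ hξ => ?_) x).trans (le_of_eq (by ring))
    · rw [norm_gradSymbol (hA.nonneg ξ)]
      have h1 := (abs_coord_mem_of_mem_strip hδ hξ i).2
      have h2 := (rpow_norm_mem_of_mem_strip hσ hξ).2
      have h3 := hA.le ξ
      have h4 := hA.nonneg ξ
      calc |ξ i| * (‖ξ‖ ^ (2 * σ) * A ξ) ≤ 1063 / 1000 * (3 / 2 * a) := by gcongr
        _ ≤ 1595 / 1000 * a := by linarith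
    · simp [gradSymbol, hA.eq_zero ξ hξ]
  rw [eLpNorm_exponent_top]
  refine eLpNormEssSup_le_of_ae_bound (Filter.Eventually.of_forall fun x => ?_)
  have hpos : 0 ≤ a * δ / 78 := by positivity
  refine (sq_le_sq₀ (norm_nonneg _) (by positivity)).1 ?_
  rw [norm_sq_eq_coords, hA.velocity_temp hσ]
  have h1 := hcomp 1 x
  have h0 := hcomp 0 x
  have e1 := sq_le_sq' (abs_le.1 h1).1 (abs_le.1 h1).2
  have e0 := sq_le_sq' (abs_le.1 h0).1 (abs_le.1 h0).2
  simp only [Matrix.cons_val_zero, Matrix.cons_val_one, neg_sq]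
  nlinarith [sq_nonneg (a * δ / 78)]

/-! ### The transport term -/

/-- The Fourier transform of the transport term. -/
def transportSymbol (σ : ℝ) (A : Plane → ℝ) (ζ : Plane) : ℂ :=
  symbolConv (gradSymbol σ 1 A) (fun ξ => Complex.I * (ξ 0 : ℂ) * (A ξ : ℂ)) ζ +
    ((-1 : ℝ) : ℂ) * symbolConv (gradSymbol σ 0 A) (fun ξ => Complex.I * (ξ 1 : ℂ) * (A ξ : ℂ)) ζ

theorem isSymbol_transportSymbol (hA : IsAmplitude δ a A) (hσ : σ ∈ ({-1 / 2, 1 / 2} : Set ℝ)) :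
    IsSymbol (transportSymbol σ A) :=
  ((hA.isSymbol_gradSymbol hσ 1).conv (hA.isSymbol.coord_mul 0)).add
    (((hA.isSymbol_gradSymbol hσ 0).conv (hA.isSymbol.coord_mul 1)).const_mul (-1))

theorem transport_temp (hA : IsAmplitude δ a A) (hσ : σ ∈ ({-1 / 2, 1 / 2} : Set ℝ)) :
    transport (velocity σ (temp A)) (temp A) = fun x => (synth (transportSymbol σ A) x).re := by
  funext x
  have h1 := (hA.isSymbol_gradSymbol hσ 1).re_synth_mul (hA.isSymbol.coord_mul 0) x
  have h0 := (hA.isSymbol_gradSymbol hσ 0).re_synth_mul (hA.isSymbol.coord_mul 1) x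
  have hp : ∀ i, partialDeriv i (temp A) =
      fun x => (synth (fun ξ => Complex.I * (ξ i : ℂ) * (A ξ : ℂ)) x).re :=
    fun i => hA.isSymbol.partialDeriv_re_synth i
  unfold transportSymbol
  rw [synth_add ((hA.isSymbol_gradSymbol hσ 1).conv (hA.isSymbol.coord_mul 0))
    (((hA.isSymbol_gradSymbol hσ 0).conv (hA.isSymbol.coord_mul 1)).const_mul (-1)),
    synth_const_mul, Complex.add_re, Complex.re_ofReal_mul, ← h1, ← h0, transport,
    Fin.sum_univ_two, hA.velocity_temp hσ, hp, hp]
  simp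

/-- The two factors `i` multiply to `-1` and the two products combine into the planar cross product
of `ξ` and `ζ - ξ`. It vanishes for parallel frequencies, which is the cancellation behind the
theorem. -/
theorem transportSymbol_eq_integral (hA : IsAmplitude δ a A)
    (hσ : σ ∈ ({-1 / 2, 1 / 2} : Set ℝ)) (ζ : Plane) :
    transportSymbol σ A ζ = (((2 * Real.pi) ^ 2)⁻¹ : ℝ) *
      ∫ ξ : Plane, (((ξ 0 * (ζ - ξ) 1 - ξ 1 * (ζ - ξ) 0) *
        (‖ξ‖ ^ (2 * σ) * A ξ) * A (ζ - ξ) : ℝ) : ℂ) := by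
  have h1 := (hA.isSymbol_gradSymbol hσ 1).integrable_mul_comp_sub (hA.isSymbol.coord_mul 0) ζ
  have h0 := (hA.isSymbol_gradSymbol hσ 0).integrable_mul_comp_sub (hA.isSymbol.coord_mul 1) ζ
  unfold transportSymbol symbolConv
  rw [mul_left_comm, ← mul_add, ← integral_const_mul, ← integral_add h1 (h0.const_mul _)]
  congr 2
  funext ξ
  simp only [gradSymbol]
  push_cast
  linear_combination ((ξ 1 * (ζ - ξ) 0 - ξ 0 * (ζ - ξ) 1 : ℂ) *
    (((‖ξ‖ ^ (2 * σ) : ℝ) : ℂ) * A ξ) * A (ζ - ξ)) * Complex.I_sq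

/-- One factor `δ` is the size of the cross product of two vectors of the strip, the other is the
area of the strip. -/
theorem norm_transportSymbol_le (hA : IsAmplitude δ a A) (hδ0 : 0 < δ) (hδ : δ ≤ 1 / 1000)
    (hσ : σ ∈ ({-1 / 2, 1 / 2} : Set ℝ)) (ζ : Plane) :
    ‖transportSymbol σ A ζ‖ ≤ δ ^ 2 * a ^ 2 := by
  have ha := hA.bound_nonneg
  rw [hA.transportSymbol_eq_integral hσ, norm_mul, Complex.norm_real,
    Real.norm_of_nonneg (by positivity)]
  have key : ∫ ξ : Plane, ‖(((ξ 0 * (ζ - ξ) 1 - ξ 1 * (ζ - ξ) 0) *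
        (‖ξ‖ ^ (2 * σ) * A ξ) * A (ζ - ξ) : ℝ) : ℂ)‖ ≤ 5 * δ * a ^ 2 * (δ / 2) := by
    refine integral_norm_le_of_strip hδ0 hδ (by positivity) (fun ξ hξ => ?_) (fun ξ hξ => ?_)
    · have hAn := hA.nonneg ξ
      have hAn' := hA.nonneg (ζ - ξ)
      rw [Complex.norm_real, norm_mul, norm_mul,
        Real.norm_of_nonneg (show 0 ≤ ‖ξ‖ ^ (2 * σ) * A ξ by positivity),
        Real.norm_of_nonneg hAn', Real.norm_eq_abs]
      by_cases hη : ζ - ξ ∈ strip δ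
      · have h1 : |ξ 0 * (ζ - ξ) 1 - ξ 1 * (ζ - ξ) 0| ≤ 3 * δ := by
          -- In this form each term contains a difference of coordinates, bounded by `δ`.
          have e : ξ 0 * (ζ - ξ) 1 - ξ 1 * (ζ - ξ) 0 =
              (ξ 0 - ξ 1) * (ζ - ξ) 0 - ξ 0 * ((ζ - ξ) 0 - (ζ - ξ) 1) := by ring
          rw [e]
          refine (abs_sub _ _).trans ?_
          rw [abs_mul, abs_mul]
          have b1 := hξ.1
          have b2 := hη.1
          have b3 := (abs_coord_mem_of_mem_strip hδ hξ 0).2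
          have b4 := (abs_coord_mem_of_mem_strip hδ hη 0).2
          calc |ξ 0 - ξ 1| * |(ζ - ξ) 0| + |ξ 0| * |(ζ - ξ) 0 - (ζ - ξ) 1|
              ≤ δ * (1063 / 1000) + 1063 / 1000 * δ := by gcongr
            _ ≤ 3 * δ := by linarith
        have h2 := (rpow_norm_mem_of_mem_strip hσ hξ).2
        have h3 := hA.le ξ
        have h4 := hA.le (ζ - ξ)
        calc |ξ 0 * (ζ - ξ) 1 - ξ 1 * (ζ - ξ) 0| * (‖ξ‖ ^ (2 * σ) * A ξ) * A (ζ - ξ)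
            ≤ 3 * δ * (3 / 2 * a) * a := by gcongr
          _ ≤ 5 * δ * a ^ 2 := by nlinarith [mul_nonneg hδ0.le (sq_nonneg a)]
      · rw [hA.eq_zero _ hη, mul_zero]
        positivity
    · simp [hA.eq_zero ξ hξ]
  calc ((2 * Real.pi) ^ 2)⁻¹ * ‖∫ ξ : Plane, (((ξ 0 * (ζ - ξ) 1 - ξ 1 * (ζ - ξ) 0) *
        (‖ξ‖ ^ (2 * σ) * A ξ) * A (ζ - ξ) : ℝ) : ℂ)‖
      ≤ 1 / 39 * (5 * δ * a ^ 2 * (δ / 2)) := by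
        gcongr
        · exact inv_two_pi_sq_mem.2
        · exact (norm_integral_le_integral_norm _).trans key
    _ ≤ δ ^ 2 * a ^ 2 := by nlinarith [mul_nonneg (sq_nonneg δ) (sq_nonneg a)]

/-- A sum of two frequencies of the strip satisfies the same inequalities with doubled constants. -/
theorem transportSymbol_eq_zero (hA : IsAmplitude δ a A)
    (hσ : σ ∈ ({-1 / 2, 1 / 2} : Set ℝ)) {ζ : Plane}
    (hζ : ¬ (|ζ 0 - ζ 1| ≤ 2 * δ ∧ ‖ζ‖ ≤ 3)) : transportSymbol σ A ζ = 0 := by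
  rw [hA.transportSymbol_eq_integral hσ, integral_eq_zero_of_ae, mul_zero]
  refine Filter.Eventually.of_forall fun ξ => ?_
  by_cases h1 : ξ ∈ strip δ
  · by_cases h2 : ζ - ξ ∈ strip δ
    · refine absurd ⟨?_, ?_⟩ hζ
      · have e : ζ 0 - ζ 1 = (ξ 0 - ξ 1) + ((ζ - ξ) 0 - (ζ - ξ) 1) := by
          simp only [PiLp.sub_apply]
          ring
        rw [e]
        exact (abs_add_le _ _).trans (by linarith [h1.1, h2.1])
      · calc ‖ζ‖ = ‖ξ + (ζ - ξ)‖ := by rw [add_sub_cancel]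
          _ ≤ ‖ξ‖ + ‖ζ - ξ‖ := norm_add_le _ _
          _ ≤ 3 := by linarith [h1.2.2, h2.2.2]
    · simp [hA.eq_zero _ h2]
  · simp [hA.eq_zero ξ h1]

theorem sobolevNorm_transport_le (hA : IsAmplitude δ a A) (hδ0 : 0 < δ) (hδ : δ ≤ 1 / 1000)
    (hσ : σ ∈ ({-1 / 2, 1 / 2} : Set ℝ)) :
    sobolevNorm 3 (transport (velocity σ (temp A)) (temp A)) ≤
      ENNReal.ofReal (30 * δ ^ (1 / 2 : ℝ) * (δ * a) ^ 2) := by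
  have hH := hA.isSymbol_transportSymbol hσ
  rw [hA.transport_temp hσ, sobolevNorm, if_pos hH.memLp_re_synth]
  set T : Set Plane := {ξ : Plane | |ξ 0 - ξ 1| ≤ 2 * δ ∧ ξ 1 ∈ Icc (-3 : ℝ) 3} with hT
  have hTm : MeasurableSet T := by
    have hdiff : Measurable fun ξ : Plane => |ξ 0 - ξ 1| := by fun_prop
    have hc : Measurable fun ξ : Plane => ξ 1 := by fun_prop
    exact (measurableSet_le hdiff measurable_const).inter (hc measurableSet_Icc)
  -- On the support the Sobolev weight is at most `10³`, and the band `T` has area `2 · 2δ · 6 =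
  -- 24δ`.
  have hinteg : ∫⁻ ξ : Plane, ENNReal.ofReal ((1 + ‖ξ‖ ^ 2) ^ (3 : ℝ) *
      ‖hat (fun x => (synth (transportSymbol σ A) x).re) ξ‖ ^ 2) ≤
      ENNReal.ofReal (1000 * (δ ^ 2 * a ^ 2) ^ 2) * ENNReal.ofReal (24 * δ) := by
    calc _ ≤ ∫⁻ ξ : Plane,
          T.indicator (fun _ => ENNReal.ofReal (1000 * (δ ^ 2 * a ^ 2) ^ 2)) ξ := by
          refine lintegral_mono_ae ?_
          filter_upwards [hH.hat_re_synth] with ξ hξ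
          rw [hξ]
          by_cases h : |ξ 0 - ξ 1| ≤ 2 * δ ∧ ‖ξ‖ ≤ 3
          · have hmem : ξ ∈ T := ⟨h.1, abs_le.1 ((PiLp.norm_apply_le ξ 1).trans h.2)⟩
            rw [indicator_of_mem hmem]
            refine ENNReal.ofReal_le_ofReal ?_
            have h1 : (1 + ‖ξ‖ ^ 2) ^ (3 : ℝ) ≤ 1000 := by
              have : 1 + ‖ξ‖ ^ 2 ≤ 10 := by nlinarith [norm_nonneg ξ, h.2]
              calc (1 + ‖ξ‖ ^ 2) ^ (3 : ℝ) ≤ (10 : ℝ) ^ (3 : ℝ) := by gcongr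
                _ = 1000 := by norm_num
            gcongr
            exact hA.norm_transportSymbol_le hδ0 hδ hσ ξ
          · rw [hA.transportSymbol_eq_zero hσ h]
            simp
      _ = ENNReal.ofReal (1000 * (δ ^ 2 * a ^ 2) ^ 2) * ENNReal.ofReal (24 * δ) := by
          rw [lintegral_indicator hTm, setLIntegral_const, hT, volume_band _ measurableSet_Icc,
            Real.volume_Icc, ← ENNReal.ofReal_mul (by positivity)]
          congr 2
          ring
  -- `24000 / 39 ≤ 900 = 30²`.
  have hreal : ((2 * Real.pi) ^ 2)⁻¹ * (1000 * (δ ^ 2 * a ^ 2) ^ 2 * (24 * δ)) ≤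
      (30 * δ ^ (1 / 2 : ℝ) * (δ * a) ^ 2) ^ 2 := by
    have e : (30 * δ ^ (1 / 2 : ℝ) * (δ * a) ^ 2) ^ 2 = 900 * ((δ ^ 2 * a ^ 2) ^ 2 * δ) := by
      have : (δ ^ (1 / 2 : ℝ)) ^ 2 = δ := by
        rw [← Real.rpow_natCast, ← Real.rpow_mul hδ0.le]
        norm_num
      calc (30 * δ ^ (1 / 2 : ℝ) * (δ * a) ^ 2) ^ 2
          = 900 * ((δ ^ 2 * a ^ 2) ^ 2 * (δ ^ (1 / 2 : ℝ)) ^ 2) := by ring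
        _ = _ := by rw [this]
    have hp : 0 ≤ (δ ^ 2 * a ^ 2) ^ 2 * δ := by positivity
    have := mul_le_mul_of_nonneg_right inv_two_pi_sq_mem.2 hp
    rw [e]
    linarith
  calc _ ≤ (ENNReal.ofReal ((30 * δ ^ (1 / 2 : ℝ) * (δ * a) ^ 2) ^ 2)) ^ (1 / 2 : ℝ) := by
        refine ENNReal.rpow_le_rpow ?_ (by norm_num)
        refine (mul_le_mul_right hinteg _).trans ?_
        rw [← ENNReal.ofReal_mul (by positivity), ← ENNReal.ofReal_mul (by positivity)]
        exact ENNReal.ofReal_le_ofReal hreal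
    _ = ENNReal.ofReal (30 * δ ^ (1 / 2 : ℝ) * (δ * a) ^ 2) := by
        rw [ENNReal.ofReal_rpow_of_nonneg (by positivity) (by norm_num), ← Real.sqrt_eq_rpow,
          Real.sqrt_sq (by positivity)]

end IsAmplitude

/-! ### Lower bounds -/

section LowerBounds

variable {δ c σ : ℝ} {X : Plane → ℝ}

theorem IsProfile.isAmplitude (hX : IsProfile δ X) (hc : 0 ≤ c) :
    IsAmplitude δ c (fun ξ => c * X ξ) where
  measurable := hX.measurable.const_mul c
  even ξ := by rw [hX.even]
  nonneg ξ := mul_nonneg hc (hX.nonneg ξ)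
  le ξ := mul_le_of_le_one_right hc (hX.le_one ξ)
  eq_zero ξ hξ := by rw [hX.eq_zero ξ hξ, mul_zero]

theorem IsProfile.mem_strip_of_ne_zero (hX : IsProfile δ X) {ξ : Plane} (h : X ξ ≠ 0) :
    ξ ∈ strip δ :=
  not_imp_comm.1 (hX.eq_zero ξ) h

theorem re_synth_eq_integral {G : Plane → ℂ} (hG : IsSymbol G) (x : Plane) :
    (synth G x).re = ((2 * Real.pi) ^ 2)⁻¹ *
      ∫ ξ : Plane, (Complex.exp (Complex.I * (inner ℝ x ξ : ℝ)) * G ξ).re := by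
  rw [synth, Complex.re_ofReal_mul]
  congr 1
  exact (integral_re (hG.integrable_exp_mul x)).symm

/-- At `x = 0` the integrand is the nonnegative symbol itself, so nothing cancels. -/
theorem IsProfile.le_eLpNorm_top_temp (hX : IsProfile δ X) (hδ0 : 0 < δ) (hδ : δ ≤ 1 / 1000)
    (hc : 0 ≤ c) :
    ENNReal.ofReal (1 / 5000 * (c * δ)) ≤ eLpNorm (temp fun ξ => c * X ξ) ⊤ volume := by
  have hA := hX.isAmplitude hc
  refine le_trans (ENNReal.ofReal_le_ofReal ?_)
    (ofReal_abs_le_eLpNorm_top_of_continuous hA.isSymbol.continuous_re_synth 0)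
  refine le_trans ?_ (le_abs_self _)
  rw [re_synth_eq_integral hA.isSymbol]
  have hinteg : c * (δ / 20) ≤ ∫ ξ : Plane, (Complex.exp (Complex.I * (inner ℝ 0 ξ : ℝ)) *
      ((c * X ξ : ℝ) : ℂ)).re := by
    refine le_integral_of_strip hδ0 hδ hc (hA.isSymbol.integrable_exp_mul 0).re (fun ξ => ?_)
      (fun ξ hξ => ?_)
    · rw [inner_zero_left, Complex.ofReal_zero, mul_zero, Complex.exp_zero, one_mul,
        Complex.ofReal_re]
      exact hA.nonneg ξ
    · rw [inner_zero_left, Complex.ofReal_zero, mul_zero, Complex.exp_zero, one_mul,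
        Complex.ofReal_re, hX.eq_one ξ hξ, mul_one]
  have hcδ : 0 ≤ c * δ := by positivity
  calc 1 / 5000 * (c * δ) ≤ 1 / 40 * (c * (δ / 20)) := by linarith
    _ ≤ _ := mul_le_mul inv_two_pi_sq_mem.1 hinteg (by positivity) (by positivity)

/-- On the strip `(ξ 0 + ξ 1) / 2` is close to `ξ 1`, and the product is even in `ξ`, so it is
positive on both components. The number comes from `sin s ≥ 2s/π`: `0.62 · 0.939 · 0.94 > 1/2`. -/
theorem half_le_sin_mul_coord (hδ : δ ≤ 1 / 1000) {ξ : Plane} (hξ : ξ ∈ strip δ) :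
    1 / 2 ≤ Real.sin ((ξ 0 + ξ 1) / 2) * ξ 1 := by
  have key : ∀ s y : ℝ, 939 / 1000 ≤ s → s ≤ 1064 / 1000 → 94 / 100 ≤ y →
      1 / 2 ≤ Real.sin s * y := by
    intro s y h1 h2 h3
    have hpi := Real.pi_gt_d2
    have hpi' := Real.pi_lt_d2
    have hs := Real.mul_le_sin (x := s) (by linarith) (by linarith)
    have hq : (62 / 100 : ℝ) ≤ 2 / Real.pi := by
      rw [le_div_iff₀ Real.pi_pos]
      linarith
    have : (62 / 100 : ℝ) * (939 / 1000) ≤ 2 / Real.pi * s := by gcongr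
    nlinarith
  obtain ⟨l0, u0⟩ := abs_coord_mem_of_mem_strip hδ hξ 0
  obtain ⟨l1, u1⟩ := abs_coord_mem_of_mem_strip hδ hξ 1
  obtain ⟨d1, d2⟩ := abs_le.1 hξ.1
  rcases abs_cases (ξ 1) with ⟨h, _⟩ | ⟨h, _⟩
  · exact key _ _ (by linarith) (by linarith) (by linarith)
  · have := key (-((ξ 0 + ξ 1) / 2)) (-ξ 1) (by linarith) (by linarith) (by linarith)
    rwa [Real.sin_neg, neg_mul_neg] at this

theorem re_exp_mul_gradSymbol (A : Plane → ℝ) (ξ : Plane) (s : ℝ) :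
    (Complex.exp (Complex.I * (s : ℂ)) * gradSymbol σ 1 A ξ).re =
      -(Real.sin s * ξ 1 * (‖ξ‖ ^ (2 * σ) * A ξ)) := by
  rw [gradSymbol, mul_comm Complex.I (s : ℂ), Complex.exp_mul_I, ← Complex.ofReal_cos,
    ← Complex.ofReal_sin]
  simp only [Complex.mul_re, Complex.mul_im, Complex.add_re, Complex.add_im, Complex.ofReal_re,
    Complex.ofReal_im, Complex.I_re, Complex.I_im]
  ring

theorem abs_coord_le_norm (x : Plane) (i : Fin 2) : |x i| ≤ ‖x‖ := PiLp.norm_apply_le x i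

theorem IsProfile.eLpNorm_component_le (hX : IsProfile δ X) (hc : 0 ≤ c)
    (hσ : σ ∈ ({-1 / 2, 1 / 2} : Set ℝ)) (p : ℝ≥0∞) :
    eLpNorm (fun x => (synth (gradSymbol σ 1 fun ξ => c * X ξ) x).re) p volume ≤
      eLpNorm (velocity σ (temp fun ξ => c * X ξ)) p volume := by
  refine eLpNorm_mono fun x => ?_
  refine le_trans (le_of_eq ?_) (abs_coord_le_norm _ 0)
  rw [(hX.isAmplitude hc).velocity_temp hσ]
  simp

theorem IsProfile.le_eLpNorm_top_velocity (hX : IsProfile δ X) (hδ0 : 0 < δ) (hδ : δ ≤ 1 / 1000)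
    (hc : 0 ≤ c) (hσ : σ ∈ ({-1 / 2, 1 / 2} : Set ℝ)) :
    ENNReal.ofReal (1 / 5000 * (c * δ)) ≤
      eLpNorm (velocity σ (temp fun ξ => c * X ξ)) ⊤ volume := by
  have hA := hX.isAmplitude hc
  have hS := hA.isSymbol_gradSymbol hσ 1
  -- The symbol is odd, so the velocity vanishes at the origin. At this point the phase is `(ξ 0 + ξ
  -- 1) / 2`, and the real part of the integrand keeps one sign.
  set x : Plane := !₂[1 / 2, 1 / 2] with hx
  refine le_trans (le_trans (ENNReal.ofReal_le_ofReal ?_)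
    (ofReal_abs_le_eLpNorm_top_of_continuous hS.continuous_re_synth x))
    (hX.eLpNorm_component_le hc hσ ⊤)
  refine le_trans ?_ (neg_le_abs _)
  have hin : ∀ ξ : Plane, inner ℝ x ξ = (ξ 0 + ξ 1) / 2 := by
    intro ξ
    rw [PiLp.inner_apply, Fin.sum_univ_two]
    simp [hx]
    ring
  rw [re_synth_eq_integral hS, ← mul_neg, ← integral_neg]
  have hinteg : c / 3 * (δ / 20) ≤ ∫ ξ : Plane, -(Complex.exp (Complex.I * (inner ℝ x ξ : ℝ)) *
      gradSymbol σ 1 (fun ξ => c * X ξ) ξ).re := by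
    refine le_integral_of_strip hδ0 hδ (by positivity) (hS.integrable_exp_mul x).re.neg
      (fun ξ => ?_) (fun ξ hξ => ?_)
    · rw [re_exp_mul_gradSymbol, neg_neg, hin]
      by_cases h0 : X ξ = 0
      · simp [h0]
      · have h1 := half_le_sin_mul_coord hδ (hX.mem_strip_of_ne_zero h0)
        have h2 := hA.nonneg ξ
        have : 0 ≤ Real.sin ((ξ 0 + ξ 1) / 2) * ξ 1 := by linarith
        positivity
    · rw [re_exp_mul_gradSymbol, neg_neg, hin, hX.eq_one ξ hξ, mul_one]
      have h1 := half_le_sin_mul_coord (δ := δ / 3) (by linarith) hξ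
      have h2 := (rpow_norm_mem_of_mem_strip hσ hξ).1
      calc c / 3 = 1 / 2 * (2 / 3 * c) := by ring
        _ ≤ _ := by gcongr
  have hcδ : 0 ≤ c * δ := by positivity
  calc 1 / 5000 * (c * δ) ≤ 1 / 40 * (c / 3 * (δ / 20)) := by linarith
    _ ≤ _ := mul_le_mul inv_two_pi_sq_mem.1 hinteg (by positivity) (by positivity)

theorem le_eLpNorm_two_of_strip (hδ0 : 0 < δ) (hδ : δ ≤ 1 / 1000) (hc : 0 ≤ c) {G : Plane → ℂ}
    (hG : IsSymbol G) (h : ∀ ξ ∈ strip (δ / 3), 1 / 2 * c ≤ ‖G ξ‖) :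
    ENNReal.ofReal (1 / 100 * (c * δ ^ (1 / 2 : ℝ))) ≤
      eLpNorm (fun x => (synth G x).re) 2 volume := by
  refine le_trans ?_ (hG.le_eLpNorm_two_re_synth (measurableSet_strip (δ / 3))
    (by positivity) h)
  have hv : ENNReal.ofReal (1 / 40 * (δ / 20)) ≤
      ENNReal.ofReal ((2 * Real.pi) ^ 2)⁻¹ * volume (strip (δ / 3)) := by
    rw [ENNReal.ofReal_mul (by norm_num)]
    exact mul_le_mul' (ENNReal.ofReal_le_ofReal inv_two_pi_sq_mem.1) (le_volume_strip hδ0 hδ)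
  refine le_trans ?_ (mul_le_mul_right (ENNReal.rpow_le_rpow hv (by norm_num)) _)
  rw [ENNReal.ofReal_rpow_of_nonneg (by positivity) (by norm_num),
    ← ENNReal.ofReal_mul (by positivity)]
  refine ENNReal.ofReal_le_ofReal ?_
  have hsplit : (1 / 40 * (δ / 20)) ^ (1 / 2 : ℝ) = (1 / 800) ^ (1 / 2 : ℝ) * δ ^ (1 / 2 : ℝ) := by
    rw [← Real.mul_rpow (by norm_num) hδ0.le]
    congr 1
    ring
  have hnum : (1 / 50 : ℝ) ≤ (1 / 800) ^ (1 / 2 : ℝ) := by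
    rw [← Real.sqrt_eq_rpow]
    exact Real.le_sqrt_of_sq_le (by norm_num)
  rw [hsplit]
  calc 1 / 100 * (c * δ ^ (1 / 2 : ℝ)) = 1 / 2 * c * (1 / 50 * δ ^ (1 / 2 : ℝ)) := by ring
    _ ≤ _ := by gcongr

theorem IsProfile.le_eLpNorm_two_temp (hX : IsProfile δ X) (hδ0 : 0 < δ) (hδ : δ ≤ 1 / 1000)
    (hc : 0 ≤ c) :
    ENNReal.ofReal (1 / 100 * (c * δ ^ (1 / 2 : ℝ))) ≤
      eLpNorm (temp fun ξ => c * X ξ) 2 volume := by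
  refine le_eLpNorm_two_of_strip hδ0 hδ hc (hX.isAmplitude hc).isSymbol fun ξ hξ => ?_
  simp only [hX.eq_one ξ hξ, mul_one, Complex.norm_real, Real.norm_of_nonneg hc]
  linarith

theorem IsProfile.le_eLpNorm_two_velocity (hX : IsProfile δ X) (hδ0 : 0 < δ) (hδ : δ ≤ 1 / 1000)
    (hc : 0 ≤ c) (hσ : σ ∈ ({-1 / 2, 1 / 2} : Set ℝ)) :
    ENNReal.ofReal (1 / 100 * (c * δ ^ (1 / 2 : ℝ))) ≤
      eLpNorm (velocity σ (temp fun ξ => c * X ξ)) 2 volume := by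
  have hA := hX.isAmplitude hc
  refine le_trans (le_eLpNorm_two_of_strip hδ0 hδ hc (hA.isSymbol_gradSymbol hσ 1)
    fun ξ hξ => ?_) (hX.eLpNorm_component_le hc hσ 2)
  rw [norm_gradSymbol (hA.nonneg ξ), hX.eq_one ξ hξ, mul_one]
  have h1 := (abs_coord_mem_of_mem_strip (δ := δ / 3) (by linarith) hξ 1).1
  have h2 := (rpow_norm_mem_of_mem_strip hσ hξ).1
  calc 1 / 2 * c ≤ 94 / 100 * (2 / 3 * c) := by linarith
    _ ≤ _ := by gcongr

end LowerBounds

/-! ### The linear flow and its time integrals -/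

section Flow

variable {δ c μ α σ : ℝ} {X : Plane → ℝ}

/-- Since `‖ξ‖ ≥ 4/3 > 1` on the strip, `‖ξ‖ ^ (2α) ≥ 1`. The decay rate `μ` is thus independent of
`α`, and so is the final `δ₀`. -/
theorem IsProfile.isAmplitude_flow (hX : IsProfile δ X) (hc : 0 ≤ c) (hμ : 0 < μ) (hα : 0 ≤ α)
    {t : ℝ} (ht : 0 ≤ t) :
    IsAmplitude δ (c * Real.exp (-μ * t))
      (fun ξ => Real.exp (-(μ * t * ‖ξ‖ ^ (2 * α))) * (c * X ξ)) where
  measurable := (Real.measurable_exp.comp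
    ((measurable_norm.pow_const _).const_mul _).neg).mul (hX.measurable.const_mul c)
  even ξ := by rw [hX.even, norm_neg]
  nonneg ξ := mul_nonneg (Real.exp_pos _).le (mul_nonneg hc (hX.nonneg ξ))
  le ξ := by
    by_cases h : ξ ∈ strip δ
    · have h1 : 1 ≤ ‖ξ‖ ^ (2 * α) :=
        Real.one_le_rpow (by linarith [h.2.1]) (by positivity)
      have h2 : μ * t ≤ μ * t * ‖ξ‖ ^ (2 * α) := le_mul_of_one_le_right (by positivity) h1
      rw [mul_comm]
      refine mul_le_mul (mul_le_of_le_one_right hc (hX.le_one ξ)) ?_ (Real.exp_pos _).le hc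
      exact Real.exp_le_exp.2 (by linarith)
    · rw [hX.eq_zero ξ h, mul_zero, mul_zero]
      positivity
  eq_zero ξ hξ := by rw [hX.eq_zero ξ hξ, mul_zero, mul_zero]

theorem IsProfile.linearFlow_temp (hX : IsProfile δ X) (hc : 0 ≤ c) (t : ℝ) :
    linearFlow μ α (temp fun ξ => c * X ξ) t =
      temp fun ξ => Real.exp (-(μ * t * ‖ξ‖ ^ (2 * α))) * (c * X ξ) := by
  unfold linearFlow temp
  rw [(hX.isAmplitude hc).isSymbol.multiplier_re_synth]
  simp only [Complex.ofReal_mul]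

theorem lintegral_exp_decay (hμ : 0 < μ) {b : ℝ} (hb : 0 ≤ b) :
    ∫⁻ t in Ioi (0 : ℝ), ENNReal.ofReal (b * Real.exp (-μ * t)) = ENNReal.ofReal (b / μ) := by
  have hi : IntegrableOn (fun t => b * Real.exp (-μ * t)) (Ioi 0) :=
    (integrableOn_exp_mul_Ioi (by linarith) 0).const_mul b
  rw [← ofReal_integral_eq_lintegral_ofReal hi
    (Filter.Eventually.of_forall fun t => by positivity), integral_const_mul,
    integral_exp_mul_Ioi (by linarith)]
  congr 1
  rw [mul_zero, Real.exp_zero]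
  field_simp

theorem IsProfile.supIntegral_le (hX : IsProfile δ X) (hδ0 : 0 < δ) (hδ : δ ≤ 1 / 1000)
    (hc : 0 ≤ c) (hμ : 0 < μ) (hα : 0 ≤ α) (hσ : σ ∈ ({-1 / 2, 1 / 2} : Set ℝ)) :
    supIntegral μ α σ (temp fun ξ => c * X ξ) ≤ ENNReal.ofReal (7 / 160 * (c * δ) / μ) := by
  rw [← lintegral_exp_decay hμ (by positivity)]
  refine setLIntegral_mono_ae' measurableSet_Ioi (Filter.Eventually.of_forall fun t ht => ?_)
  have hA := hX.isAmplitude_flow hc hμ hα (le_of_lt ht)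
  have hpos : 0 ≤ c * Real.exp (-μ * t) * δ / 78 := by positivity
  rw [hX.linearFlow_temp hc]
  refine (add_le_add (hA.eLpNorm_top_velocity_le hδ0 hδ hσ)
    (hA.eLpNorm_top_temp_le hδ0 hδ)).trans ?_
  rw [← ENNReal.ofReal_add (by positivity) hpos]
  refine ENNReal.ofReal_le_ofReal ?_
  -- `3.256 / 78 ≤ 7/160`; the latter is chosen because `40 · 7/160 = 7/4`, which stays below the
  -- exponent `2` of `|log δ|` in `ε`.
  calc 2256 / 1000 * (c * Real.exp (-μ * t) * δ / 78) + c * Real.exp (-μ * t) * δ / 78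
      = 3256 / 78000 * (c * δ * Real.exp (-μ * t)) := by ring
    _ ≤ 7 / 160 * (c * δ * Real.exp (-μ * t)) :=
        mul_le_mul_of_nonneg_right (by norm_num) (by positivity)
    _ = _ := by ring

theorem IsProfile.transportIntegral_le (hX : IsProfile δ X) (hδ0 : 0 < δ) (hδ : δ ≤ 1 / 1000)
    (hc : 0 ≤ c) (hμ : 0 < μ) (hα : 0 ≤ α) (hσ : σ ∈ ({-1 / 2, 1 / 2} : Set ℝ)) :
    transportIntegral μ α σ (temp fun ξ => c * X ξ) ≤
      ENNReal.ofReal (30 * δ ^ (1 / 2 : ℝ) * (c * δ) ^ 2 / μ) := by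
  rw [← lintegral_exp_decay hμ (by positivity)]
  refine setLIntegral_mono_ae' measurableSet_Ioi (Filter.Eventually.of_forall fun t ht => ?_)
  have hA := hX.isAmplitude_flow hc hμ hα (le_of_lt ht)
  rw [hX.linearFlow_temp hc]
  refine (hA.sobolevNorm_transport_le hδ0 hδ hσ).trans (ENNReal.ofReal_le_ofReal ?_)
  have ht' : 0 < t := ht
  have he : Real.exp (-μ * t) ≤ 1 := Real.exp_le_one_iff.2 (by nlinarith)
  -- The quadratic term decays like `e^(-2μt)`; the weaker rate is enough.
  have he2 : Real.exp (-μ * t) ^ 2 ≤ Real.exp (-μ * t) := by nlinarith [Real.exp_pos (-μ * t)]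
  calc 30 * δ ^ (1 / 2 : ℝ) * (δ * (c * Real.exp (-μ * t))) ^ 2
      = 30 * δ ^ (1 / 2 : ℝ) * (c * δ) ^ 2 * Real.exp (-μ * t) ^ 2 := by ring
    _ ≤ _ := by gcongr

end Flow

/-! ### Small parameters -/

/-- The parameters for which the estimates close. -/
structure IsSmallParam (μ δ : ℝ) : Prop where
  pos : 0 < δ
  le : δ ≤ 1 / 1000
  one_le_log : 1 ≤ |Real.log δ|
  eps_le : δ ^ (1 / 2 : ℝ) * |Real.log δ| ^ 2 ≤ Real.exp (-100)
  exp_le : δ ^ (1 / 2 : ℝ) * Real.log |Real.log δ| ^ 2 ≤ 1 / 1200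
  growth : (1 + 30 / μ * Real.log |Real.log δ| ^ 2) * Real.exp 1 ≤ |Real.log δ| ^ (1 / 4 : ℝ)

theorem tendsto_abs_log_zero :
    Filter.Tendsto (fun δ : ℝ => |Real.log δ|) (nhdsWithin 0 (Ioi 0)) Filter.atTop :=
  Filter.tendsto_abs_atBot_atTop.comp Real.tendsto_log_nhdsGT_zero

theorem eventually_log_growth (μ : ℝ) : ∀ᶠ y : ℝ in Filter.atTop,
    (1 + 30 / μ * Real.log y ^ 2) * Real.exp 1 ≤ y ^ (1 / 4 : ℝ) := by
  have h1 : (fun y : ℝ => Real.log y ^ (2 : ℝ)) =o[Filter.atTop] fun y => y ^ (1 / 4 : ℝ) :=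
    isLittleO_log_rpow_rpow_atTop 2 (by norm_num)
  have h0 : (fun _ : ℝ => (1 : ℝ)) =o[Filter.atTop] fun y => y ^ (1 / 4 : ℝ) := by
    rw [Asymptotics.isLittleO_const_left]
    right
    exact tendsto_norm_atTop_atTop.comp (tendsto_rpow_atTop (by norm_num))
  have h := ((h0.add (h1.const_mul_left (30 / μ))).const_mul_left (Real.exp 1)).bound one_pos
  filter_upwards [h, Filter.eventually_ge_atTop 0] with y hy hy0
  rw [one_mul, Real.norm_of_nonneg (by positivity : (0 : ℝ) ≤ y ^ (1 / 4 : ℝ))] at hy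
  refine le_trans (le_of_eq ?_) ((le_abs_self _).trans hy)
  rw [mul_comm, Real.rpow_two]

theorem tendsto_eps : Filter.Tendsto (fun δ : ℝ => δ ^ (1 / 2 : ℝ) * |Real.log δ| ^ 2)
    (nhdsWithin 0 (Ioi 0)) (nhds 0) := by
  -- With `u = |log δ| / 2` and `δ < 1`, the quantity is `4 u² e^(-u)`.
  have h := (Real.tendsto_pow_mul_exp_neg_atTop_nhds_zero 2).comp
    (tendsto_abs_log_zero.atTop_mul_const (show (0 : ℝ) < 1 / 2 by norm_num))
  have h4 := h.const_mul 4
  rw [mul_zero] at h4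
  refine h4.congr' ?_
  filter_upwards [self_mem_nhdsWithin, Ioo_mem_nhdsGT one_pos] with δ h0 h1
  have h0' : 0 < δ := h0
  rw [Function.comp, Real.rpow_def_of_pos h0', abs_of_neg (Real.log_neg h0' h1.2)]
  rw [show Real.log δ * (1 / 2) = -(-Real.log δ * (1 / 2)) by ring]
  ring

theorem eventually_isSmallParam (μ : ℝ) :
    ∀ᶠ δ : ℝ in nhdsWithin 0 (Ioi 0), IsSmallParam μ δ := by
  filter_upwards [self_mem_nhdsWithin, Ioo_mem_nhdsGT (show (0 : ℝ) < 1 / 1000 by norm_num),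
    tendsto_abs_log_zero.eventually_ge_atTop 1,
    tendsto_eps.eventually_le_const (Real.exp_pos (-100)),
    tendsto_eps.eventually_le_const (show (0 : ℝ) < 1 / 1200 by norm_num),
    tendsto_abs_log_zero.eventually (eventually_log_growth μ)] with δ h0 h1 h2 h3 h4 h5
  have h0' : 0 < δ := h0
  refine ⟨h0', h1.2.le, h2, h3, le_trans ?_ h4, h5⟩
  -- As `log y ≤ y`, the bound `exp_le` follows from the smallness of `δ^(1/2) |log δ|²`.
  have hl : 0 ≤ Real.log |Real.log δ| := Real.log_nonneg h2
  gcongr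
  exact Real.log_le_self (abs_nonneg _)

namespace IsSmallParam

variable {μ δ : ℝ}

theorem loglog_nonneg (h : IsSmallParam μ δ) : 0 ≤ Real.log |Real.log δ| :=
  Real.log_nonneg h.one_le_log

theorem amplitude_nonneg (h : IsSmallParam μ δ) : 0 ≤ δ⁻¹ * Real.log |Real.log δ| :=
  mul_nonneg (inv_nonneg.2 h.pos.le) h.loglog_nonneg

theorem amplitude_mul (h : IsSmallParam μ δ) :
    δ⁻¹ * Real.log |Real.log δ| * δ = Real.log |Real.log δ| := by
  have := h.pos.ne'
  field_simp

theorem amplitude_mul_sqrt (h : IsSmallParam μ δ) :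
    δ⁻¹ * Real.log |Real.log δ| * δ ^ (1 / 2 : ℝ) =
      δ ^ (-1 / 2 : ℝ) * Real.log |Real.log δ| := by
  have : δ ^ (-1 / 2 : ℝ) = δ⁻¹ * δ ^ (1 / 2 : ℝ) := by
    rw [← Real.rpow_neg_one, ← Real.rpow_add h.pos]
    norm_num
  rw [this]
  ring

/-- The exponent `2` of `|log δ|` splits as `7/4 + 1/4`: the first part is `exp (C S)`, the second
pays for the prefactor and for `exp (C T) ≤ e`. The constant `1/1200 = 1/(40 · 30)` in `exp_le` is
what makes `C T ≤ 1`. -/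
theorem smallness_real (h : IsSmallParam μ δ) {C g S T : ℝ} (hμ : 0 < μ) (hC : 0 < C)
    (hCμ : C ≤ 40 * μ) (hg : g ≤ δ ^ (1 / 2 : ℝ)) (hT0 : 0 ≤ T)
    (hS : S ≤ 7 / 160 * Real.log |Real.log δ| / μ)
    (hT : T ≤ 30 * δ ^ (1 / 2 : ℝ) * Real.log |Real.log δ| ^ 2 / μ) :
    (g + T) * Real.exp (C * (S + T)) ≤ δ ^ (1 / 2 : ℝ) * |Real.log δ| ^ 2 := by
  set L := Real.log |Real.log δ| with hL
  set l := |Real.log δ| with hl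
  have hL0 : 0 ≤ L := h.loglog_nonneg
  have hl0 : 0 < l := one_pos.trans_le h.one_le_log
  have hδ0 := h.pos
  have hCS : C * S ≤ 7 / 4 * L := by
    calc C * S ≤ C * (7 / 160 * L / μ) := by gcongr
      _ ≤ 40 * μ * (7 / 160 * L / μ) := by gcongr
      _ = 7 / 4 * L := by field_simp; ring
  have hCT : C * T ≤ 1 := by
    calc C * T ≤ 40 * μ * (30 * δ ^ (1 / 2 : ℝ) * L ^ 2 / μ) := by gcongr
      _ = 1200 * (δ ^ (1 / 2 : ℝ) * L ^ 2) := by field_simp; ring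
      _ ≤ 1 := by linarith [h.exp_le]
  have hexp : Real.exp (C * (S + T)) ≤ l ^ (7 / 4 : ℝ) * Real.exp 1 := by
    rw [Real.rpow_def_of_pos hl0, ← Real.exp_add]
    exact Real.exp_le_exp.2 (by linarith)
  have hsum : g + T ≤ δ ^ (1 / 2 : ℝ) * (1 + 30 / μ * L ^ 2) := by
    calc g + T ≤ δ ^ (1 / 2 : ℝ) + 30 * δ ^ (1 / 2 : ℝ) * L ^ 2 / μ := add_le_add hg hT
      _ = _ := by ring
  calc (g + T) * Real.exp (C * (S + T))
      ≤ δ ^ (1 / 2 : ℝ) * (1 + 30 / μ * L ^ 2) * (l ^ (7 / 4 : ℝ) * Real.exp 1) := by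
        gcongr
    _ = δ ^ (1 / 2 : ℝ) * l ^ (7 / 4 : ℝ) * ((1 + 30 / μ * L ^ 2) * Real.exp 1) := by ring
    _ ≤ δ ^ (1 / 2 : ℝ) * l ^ (7 / 4 : ℝ) * l ^ (1 / 4 : ℝ) := by
        gcongr
        exact h.growth
    _ = δ ^ (1 / 2 : ℝ) * l ^ 2 := by
        rw [mul_assoc, ← Real.rpow_add hl0, ← Real.rpow_two]
        norm_num

end IsSmallParam

/-! ### Assembling the estimates for the initial temperature -/

theorem initialTemp_eq_temp (δ : ℝ) (X : Plane → ℝ) :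
    initialTemp δ (fun x => (synth (fun ξ => (X ξ : ℂ)) x).re) =
      temp fun ξ => δ⁻¹ * Real.log |Real.log δ| * X ξ := by
  funext x
  unfold initialTemp temp
  simp only [Complex.ofReal_mul (δ⁻¹ * Real.log |Real.log δ|)]
  rw [synth_const_mul, Complex.re_ofReal_mul]

theorem IsSmallParam.smallnessCondition {μ δ C α σ : ℝ} (h : IsSmallParam μ δ) (hμ : 0 < μ)
    (hC : 0 < C) (hCμ : C ≤ 40 * μ) (hα : 0 ≤ α) (hσ : σ ∈ ({-1 / 2, 1 / 2} : Set ℝ))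
    {χ g₀ : Plane → ℝ} (hχ : IsStripCutoff δ χ)
    (hg : sobolevNorm 3 g₀ ^ 2 ≤ ENNReal.ofReal (δ ^ (1 / 2 : ℝ))) :
    SmallnessCondition C (δ ^ (1 / 2 : ℝ) * |Real.log δ| ^ 2) μ α σ (initialTemp δ χ) g₀ := by
  obtain ⟨X, hX, rfl⟩ := hχ.exists_profile h.pos
  have hδ0 := h.pos
  have hL := h.loglog_nonneg
  have hS := hX.supIntegral_le h.pos h.le h.amplitude_nonneg hμ hα hσ
  have hT := hX.transportIntegral_le h.pos h.le h.amplitude_nonneg hμ hα hσ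
  rw [h.amplitude_mul] at hS hT
  have hgt : sobolevNorm 3 g₀ ≠ ⊤ := by
    intro htop
    rw [htop] at hg
    simp at hg
  rw [initialTemp_eq_temp]
  refine ⟨hgt, (hS.trans_lt ENNReal.ofReal_lt_top).ne, (hT.trans_lt ENNReal.ofReal_lt_top).ne,
    h.smallness_real hμ hC hCμ ?_ ENNReal.toReal_nonneg
      (ENNReal.toReal_le_of_le_ofReal (by positivity) hS)
      (ENNReal.toReal_le_of_le_ofReal (by positivity) hT)⟩
  rw [← ENNReal.toReal_pow]
  exact ENNReal.toReal_le_of_le_ofReal (by positivity) hg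

theorem IsSmallParam.lower_bounds {μ δ σ : ℝ} (h : IsSmallParam μ δ)
    (hσ : σ ∈ ({-1 / 2, 1 / 2} : Set ℝ)) {χ : Plane → ℝ} (hχ : IsStripCutoff δ χ) :
    ENNReal.ofReal (1 / 5000 * Real.log |Real.log δ|) ≤
        eLpNorm (velocity σ (initialTemp δ χ)) ⊤ volume ∧
      ENNReal.ofReal (1 / 100 * δ ^ (-1 / 2 : ℝ) * Real.log |Real.log δ|) ≤
        eLpNorm (velocity σ (initialTemp δ χ)) 2 volume ∧
      ENNReal.ofReal (1 / 5000 * Real.log |Real.log δ|) ≤ eLpNorm (initialTemp δ χ) ⊤ volume ∧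
      ENNReal.ofReal (1 / 100 * δ ^ (-1 / 2 : ℝ) * Real.log |Real.log δ|) ≤
        eLpNorm (initialTemp δ χ) 2 volume := by
  obtain ⟨X, hX, rfl⟩ := hχ.exists_profile h.pos
  have hc := h.amplitude_nonneg
  have h1 := hX.le_eLpNorm_top_velocity h.pos h.le hc hσ
  have h2 := hX.le_eLpNorm_two_velocity h.pos h.le hc hσ
  have h3 := hX.le_eLpNorm_top_temp h.pos h.le hc
  have h4 := hX.le_eLpNorm_two_temp h.pos h.le hc
  rw [h.amplitude_mul] at h1 h3
  rw [h.amplitude_mul_sqrt, ← mul_assoc] at h2 h4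
  rw [initialTemp_eq_temp]
  exact ⟨h1, h2, h3, h4⟩

end SQG

end

theorem corollary1p3 (μ C : ℝ) (hμ : 0 < μ) (hC : 0 < C) (hCμ : C ≤ 40 * μ) :
    ∃ δ₀ : ℝ, 0 < δ₀ ∧
      (∀ δ ∈ Set.Ioc 0 δ₀, ∀ α ∈ Set.Ico (0 : ℝ) (1 / 2), ∀ σ ∈ ({-1 / 2, 1 / 2} : Set ℝ),
        ∀ χ : SQG.Plane → ℝ, SQG.IsStripCutoff δ χ →
        ∀ g₀ : SQG.Plane → ℝ,
          SQG.sobolevNorm 3 g₀ ^ 2 ≤ ENNReal.ofReal (δ ^ (1 / 2 : ℝ)) →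
          0 < δ ^ (1 / 2 : ℝ) * |Real.log δ| ^ 2 ∧
          δ ^ (1 / 2 : ℝ) * |Real.log δ| ^ 2 ≤ Real.exp (-100) ∧
          SQG.SmallnessCondition C (δ ^ (1 / 2 : ℝ) * |Real.log δ| ^ 2) μ α σ
            (SQG.initialTemp δ χ) g₀ ∧
          ENNReal.ofReal (1 / 5000 * Real.log |Real.log δ|) ≤
            eLpNorm (SQG.velocity σ (SQG.initialTemp δ χ)) ⊤ volume ∧
          ENNReal.ofReal (1 / 100 * δ ^ (-1 / 2 : ℝ) * Real.log |Real.log δ|) ≤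
            eLpNorm (SQG.velocity σ (SQG.initialTemp δ χ)) 2 volume ∧
          ENNReal.ofReal (1 / 5000 * Real.log |Real.log δ|) ≤
            eLpNorm (SQG.initialTemp δ χ) ⊤ volume ∧
          ENNReal.ofReal (1 / 100 * δ ^ (-1 / 2 : ℝ) * Real.log |Real.log δ|) ≤
            eLpNorm (SQG.initialTemp δ χ) 2 volume) ∧
      (∀ K : ℝ, ∃ δ ∈ Set.Ioc 0 δ₀, ∃ χ : SQG.Plane → ℝ, SQG.IsStripCutoff δ χ ∧
        ∀ σ ∈ ({-1 / 2, 1 / 2} : Set ℝ),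
          ENNReal.ofReal K ≤ eLpNorm (SQG.velocity σ (SQG.initialTemp δ χ)) ⊤ volume ∧
          ENNReal.ofReal K ≤ eLpNorm (SQG.velocity σ (SQG.initialTemp δ χ)) 2 volume ∧
          ENNReal.ofReal K ≤ eLpNorm (SQG.initialTemp δ χ) ⊤ volume ∧
          ENNReal.ofReal K ≤ eLpNorm (SQG.initialTemp δ χ) 2 volume) := by
  obtain ⟨δ₀, hδ₀, hsmall⟩ := mem_nhdsGT_iff_exists_Ioc_subset.1 (SQG.eventually_isSmallParam μ)
  refine ⟨δ₀, hδ₀, ?_, ?_⟩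
  · intro δ hδ α hα σ hσ χ hχ g₀ hg
    have h : SQG.IsSmallParam μ δ := hsmall hδ
    have hpos := h.pos
    have hl : 0 < |Real.log δ| := one_pos.trans_le h.one_le_log
    exact ⟨by positivity, h.eps_le, h.smallnessCondition hμ hC hCμ hα.1 hσ hχ hg,
      h.lower_bounds hσ hχ⟩
  · intro K
    -- `log |log δ| → ∞` as `δ → 0⁺`, so the sup-norm bounds exceed `K`; the `L²` bounds are larger
    -- still, because `δ^(-1/2) ≥ 1`.
    have hbig := (Real.tendsto_log_atTop.comp SQG.tendsto_abs_log_zero).eventually_ge_atTop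
      (5000 * K)
    obtain ⟨δ, hK, hδ⟩ := (hbig.and (Ioc_mem_nhdsGT hδ₀)).exists
    have h : SQG.IsSmallParam μ δ := hsmall hδ
    have hL := h.loglog_nonneg
    have hχ := (SQG.isProfile_indicator h.pos).isStripCutoff
    have hK' : K ≤ 1 / 5000 * Real.log |Real.log δ| := by
      have : 5000 * K ≤ Real.log |Real.log δ| := hK
      linarith
    have hK2 : K ≤ 1 / 100 * δ ^ (-1 / 2 : ℝ) * Real.log |Real.log δ| := by
      have h1 : 1 ≤ δ ^ (-1 / 2 : ℝ) :=
        Real.one_le_rpow_of_pos_of_le_one_of_nonpos h.pos (by linarith [h.le]) (by norm_num)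
      nlinarith
    refine ⟨δ, hδ, _, hχ, fun σ hσ => ?_⟩
    obtain ⟨h1, h2, h3, h4⟩ := h.lower_bounds hσ hχ
    exact ⟨(ENNReal.ofReal_le_ofReal hK').trans h1, (ENNReal.ofReal_le_ofReal hK2).trans h2,
      (ENNReal.ofReal_le_ofReal hK').trans h3, (ENNReal.ofReal_le_ofReal hK2).trans h4⟩
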